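/- **Model.** Users are $u=0,1,2,\dots$; the system of size $n$ consists of the users $u<n$ and records $m=m(n)$ data points $X_u(k)\in\{0,1\}$ per user, where $m(n)\to\infty$. An association graph $G$ with edge set $F$ on the users is given, all of whose connected components have at most $2$ vertices. The parameters $p_u$ are drawn i.i.d. from a density $f_P$ on $(0,1)$ with $\delta_1\le f_P\le\delta_2$ on $(0,1)$ for some $\delta_1,\delta_2>0$. Given the $p_u$'s, the correlation coefficients $\rho_{uu'}$, $(u,u')\in F$, are drawn independently, $\rho_{uu'}$ from a conditional density given $(p_u,p_{u'})$ that is supported on the set of possible correlation coefficients of a pair of Bernoulli variables with parameters $p_u,p_{u'}$ (for instance on $\big[0,\min\{\sqrt{\tfrac{p_u(1-p_{u'})}{p_{u'}(1-p_u)}},\sqrt{\tfrac{p_{u'}(1-p_u)}{p_u(1-p_{u'})}}\}\big]$). Given all $p$ and $\rho$, the data are i.i.d. over the times $k$; at each time different components are independent, $X_u(k)\sim\mathrm{Bernoulli}(p_u)$, and $X_u(k),X_{u'}(k)$ have correlation coefficient $\rho_{uu'}$ for $(u,u')\in F$. **Schemes.** A scheme consists of the following three stages. (1) Each pair $(u,u')\in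 F$ of users of the system passes its samples jointly, independently over time, through a channel $\{0,1\}^2\to\{0,1\}^2$ that depends only on $(p_u,p_{u'},\rho_{uu'})$ and whose two output samples are independent of each other; users without an associate in the system change nothing. (2) Each user $u$, independently, draws once a flip probability $R_u\in[0,a_n]$, where $a_n\in(0,1]$ and $a_n\to0$, from a law depending only on $n$ and on the parameter of the user's samples after stage (1), and then flips each sample independently with probability $R_u$; the result is $Z_u(k)$. (3) A uniformly random permutation $\Pi$ of the $n$ users, independent of everything else, is applied: $Y_u=Z_{\Pi^{-1}(u)}$, and $\mathbf Y=(Y_u(k))_{u<n,\,k<m}$ is what the adversary observes. For a finite nonempty set $U$ of users the asymptotic noise level is $$a(U)=\inf\Big\{a\ge0:\ P\Big(\tfrac{1}{m|U|}\sum_{u\in U}|\{k:Z_u(k)\ne X_u(k)\}|>a\Big)\to0\text{ as }n\to\infty,\ m=m(n)\Big\}.$$ A user $u$ has perfect privacy if $\lim_{n\to\infty}I(X_u(k);\mathbf Y)=0$ for every $k$. Probabilities and mutual information are taken given the realization of all parameters $p$ and $\rho$ (so the adversary may know them). **Theorem.** There is a scheme such that for almost every realization of the parameters $p$ and $\rho$,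 and for every function $m=m(n)$ with $m(n)\to\infty$ (however fast): every user has perfect privacy, and for every $(u,u')\in F$ the asymptotic noise levels $a(\{u\})$, $a(\{u'\})$ and $a(\{u,u'\})$ are all at most $$\frac{|\mathrm{Cov}(X_u(k),X_{u'}(k))|}{\max\{p_u,p_{u'},1-p_u,1-p_{u'}\}}.$$ -/

import Mathlib

open MeasureTheory ProbabilityTheory Filter Topology

noncomputable section

namespace CollabPrivacy

/-! ### Two correlated Bernoulli samples -/

/-- Mass function of the Bernoulli distribution with parameter `p` (`true` is state `1`). -/
def bern (p : ℝ) (x : Bool) : ℝ := if x then p else 1 - p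

/-- Joint mass function of two `{0,1}`-valued variables with means `p`, `p'` and correlation
coefficient `ρ`. -/
def pairMass (p p' ρ : ℝ) (x y : Bool) : ℝ :=
  bern p x * bern p' y + (if x = y then 1 else -1) * (ρ * √(p * (1 - p) * (p' * (1 - p'))))

/-- `ρ` is a possible correlation coefficient of Bernoulli variables with parameters `p`, `p'`.
For `ρ ≥ 0` this says that
`ρ ≤ min {√(p(1-p') / (p'(1-p))), √(p'(1-p) / (p(1-p')))}`. -/
def Feasible (p p' ρ : ℝ) : Prop := ∀ x y, 0 ≤ pairMass p p' ρ x y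

/-- A state as a real number. -/
def val (x : Bool) : ℝ := if x then 1 else 0

/-- Expectation of `h (X, X')` under the joint mass function `pairMass`. -/
def pairExp (p p' ρ : ℝ) (h : Bool → Bool → ℝ) : ℝ :=
  ∑ x, ∑ y, pairMass p p' ρ x y * h x y

/-- `Cov (X, X')` under the joint mass function `pairMass`. -/
def pairCov (p p' ρ : ℝ) : ℝ :=
  pairExp p p' ρ (fun x y => val x * val y)
    - pairExp p p' ρ (fun x _ => val x) * pairExp p p' ρ (fun _ y => val y)

/-- `|Cov (X, X')| / max {p, p', 1 - p, 1 - p'}`. -/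
def pairNoiseBound (p p' ρ : ℝ) : ℝ :=
  |pairCov p p' ρ| / max (max p p') (max (1 - p) (1 - p'))

/-! ### The data of the users

The users are `0, 1, 2, …`; the system of size `n` consists of the users `u < n`. The association
graph `G` is a graph on all users. The vector `p` holds the parameters of the users; for an edge
between `u < v`, the number `ρ (u, v)` is the correlation coefficient of the two users. -/

/-- User `u` has no associated user within the system of size `n`. -/
def IsolatedIn (G : SimpleGraph ℕ) (n : ℕ) (u : Fin n) : Prop := ∀ v : Fin n, ¬ G.Adj u v

open scoped Classical in
/-- The users of the system of size `n` that are isolated in it. -/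
def isolated (G : SimpleGraph ℕ) (n : ℕ) : Finset (Fin n) := {u | IsolatedIn G n u}

open scoped Classical in
/-- The edges of the system of size `n`, each one listed once, smaller user first. -/
def edges (G : SimpleGraph ℕ) (n : ℕ) : Finset (Fin n × Fin n) := {e | e.1 < e.2 ∧ G.Adj e.1 e.2}

/-- Mass function of the data `(X_u(k))_{u < n}` of all users at one time `k`, for an association
graph with groups of size at most `2`: different groups are independent, an isolated user is
Bernoulli `p u`, and an associated pair has the joint mass function `pairMass`. -/
def dataMass (G : SimpleGraph ℕ) (p : ℕ → ℝ) (ρ : ℕ × ℕ → ℝ) (n : ℕ) (x : Fin n → Bool) : ℝ :=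
  (∏ u ∈ isolated G n, bern (p u) (x u)) *
    ∏ e ∈ edges G n, pairMass (p e.1) (p e.2) (ρ (e.1, e.2)) (x e.1) (x e.2)

/-! ### Obfuscation and anonymization schemes -/

/-- A scheme made of collaborative obfuscation, a second independent obfuscation, and anonymization.

* Stage 1. Two associated users jointly pass their samples, at every time independently, through
  the channel `decor p p' ρ`, which makes them independent of each other. A user without associate
  does nothing.
* Stage 2. Every user `u`, independently of the others, draws a flip probability `R_u` once, from
  the law `flipLaw n q`, where `q` is the parameter of his samples after stage 1, and passes all his
  samples through a binary symmetric channel with error probability `R_u`. The flip probabilities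
  are at most `a n`, where `a n → 0`.
* Stage 3. The users are permuted by a uniformly random permutation. -/
structure Scheme where
  decor : (p p' ρ : ℝ) → Bool × Bool → PMF (Bool × Bool)
  decorrelates : ∀ p ∈ Set.Ioo (0 : ℝ) 1, ∀ p' ∈ Set.Ioo (0 : ℝ) 1, ∀ ρ, Feasible p p' ρ →
    ∃ q q' : ℝ, ∀ z z' : Bool,
      pairExp p p' ρ (fun x y => (decor p p' ρ (x, y) (z, z')).toReal) = bern q z * bern q' z'
  a : ℕ → ℝ
  a_mem : ∀ n, a n ∈ Set.Ioc (0 : ℝ) 1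
  a_tendsto : Tendsto a atTop (𝓝 0)
  flipLaw : ℕ → ℝ → Measure ℝ
  flipLaw_prob : ∀ n q, IsProbabilityMeasure (flipLaw n q)
  flipLaw_supp : ∀ n q, ∀ᵐ r ∂flipLaw n q, r ∈ Set.Icc 0 (a n)

/-- Permutations of the users form a discrete measurable space. -/
instance permMeasurableSpace (n : ℕ) : MeasurableSpace (Equiv.Perm (Fin n)) := ⊤

/-- The sample space of the system with `n` users and `m` data points per user. Its coordinates are
the data of all users before and after stage 1 at each time, the flip probabilities `R_u`,
the uniform variables that realize the flips of stage 2, and the permutation. -/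
abbrev Sample (n m : ℕ) : Type :=
  (Fin m → (Fin n → Bool) × (Fin n → Bool)) × (Fin n → ℝ) ×
    (Fin m → Fin n → unitInterval) × Equiv.Perm (Fin n)

section

variable {n m : ℕ}

/-- The data `X_u(k)`. -/
def dataX (ω : Sample n m) (k : Fin m) (u : Fin n) : Bool := (ω.1 k).1 u

/-- The data after stage 1. -/
def stageOne (ω : Sample n m) (k : Fin m) (u : Fin n) : Bool := (ω.1 k).2 u

open scoped Classical in
/-- The obfuscated data `Z_u(k)`: the data after stage 1, flipped with probability `R_u`. -/
def dataZ (ω : Sample n m) (k : Fin m) (u : Fin n) : Bool :=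
  if (ω.2.2.1 k u : ℝ) < ω.2.1 u then !(stageOne ω k u) else stageOne ω k u

/-- The anonymized data `Y_u(k)`, with `Y_u = Z_{Π⁻¹(u)}`. -/
def dataY (ω : Sample n m) (k : Fin m) (u : Fin n) : Bool := dataZ ω k (ω.2.2.2.symm u)

/-- The fraction of corrupted data points among the users of the set `U`. -/
def noiseFraction (U : Finset ℕ) (ω : Sample n m) : ℝ :=
  (∑ u ∈ Finset.univ.filter (fun u : Fin n => (u : ℕ) ∈ U),
      ((Finset.univ.filter fun k : Fin m => dataZ ω k u ≠ dataX ω k u).card : ℝ)) /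
    (m * U.card)

end

namespace Scheme

variable (S : Scheme) (G : SimpleGraph ℕ) (p : ℕ → ℝ) (ρ : ℕ × ℕ → ℝ)

open scoped Classical in
/-- Probability that stage 1 turns the data `x` of all users at one time into `z`. -/
def stageOneMass (n : ℕ) (x z : Fin n → Bool) : ℝ :=
  (∏ u ∈ isolated G n, if z u = x u then 1 else 0) *
    ∏ e ∈ edges G n,
      (S.decor (p e.1) (p e.2) (ρ (e.1, e.2)) (x e.1, x e.2) (z e.1, z e.2)).toReal

/-- Joint law, at one time, of the data of all users before and after stage 1. -/
def stepLaw (n : ℕ) : Measure ((Fin n → Bool) × (Fin n → Bool)) :=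
  ∑ x : Fin n → Bool, ∑ z : Fin n → Bool,
    ENNReal.ofReal (dataMass G p ρ n x * S.stageOneMass G p ρ n x z) • Measure.dirac (x, z)

/-- The probability that a sample of user `u` is in state `1` after stage 1. -/
def outParam (n : ℕ) (u : Fin n) : ℝ := (S.stepLaw G p ρ n).real {s | s.2 u = true}

/-- The probability measure on the sample space, given the parameters `p` and `ρ`: the data points
are i.i.d. in time, and flip probabilities, flips and permutation are independent of them. -/
def law (n m : ℕ) : Measure (Sample n m) :=
  (Measure.pi fun _ : Fin m => S.stepLaw G p ρ n).prod <|
    (Measure.pi fun u : Fin n => S.flipLaw n (S.outParam G p ρ n u)).prod <|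
      (Measure.pi fun _ : Fin m => Measure.pi fun _ : Fin n => (volume : Measure unitInterval)).prod
        (PMF.uniformOfFintype (Equiv.Perm (Fin n))).toMeasure

end Scheme

/-! ### Perfect privacy and asymptotic noise level -/

/-- Mutual information `I(A; B)` of two random variables with finitely many values. -/
def mutualInfo {Ω α β : Type*} [MeasurableSpace Ω] [Fintype α] [Fintype β] (μ : Measure Ω)
    (A : Ω → α) (B : Ω → β) : ℝ :=
  ∑ a, ∑ b, μ.real {ω | A ω = a ∧ B ω = b} *
    Real.log (μ.real {ω | A ω = a ∧ B ω = b} / (μ.real {ω | A ω = a} * μ.real {ω | B ω = b}))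

namespace Scheme

variable (S : Scheme) (G : SimpleGraph ℕ) (p : ℕ → ℝ) (ρ : ℕ × ℕ → ℝ)

open scoped Classical in
/-- User `u` has perfect privacy if `I(X_u(k); Y) → 0` as `n → ∞`, for every time `k`, when the
system of size `n` has `m n` data points per user. All probabilities are given the parameters `p`,
`ρ`, which the adversary knows. (The value `0` concerns the finitely many `n` for which the user or
the time does not exist yet.) -/
def PerfectPrivacy (m : ℕ → ℕ) (u : ℕ) : Prop :=
  ∀ k : ℕ, Tendsto (fun n => if h : u < n ∧ k < m n then
      mutualInfo (S.law G p ρ n (m n))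
        (fun ω => dataX ω ⟨k, h.2⟩ ⟨u, h.1⟩) (fun ω => dataY ω)
    else 0) atTop (𝓝 0)

/-- Asymptotic noise level for the set of users `U`, when the system of size `n` has `m n` data
points per user. -/
def asymptoticNoiseLevel (m : ℕ → ℕ) (U : Finset ℕ) : ℝ :=
  sInf {a : ℝ | 0 ≤ a ∧
    Tendsto (fun n => (S.law G p ρ n (m n)).real {ω | a < noiseFraction U ω}) atTop (𝓝 0)}

end Scheme

end CollabPrivacy

end

noncomputable section

namespace CollabPrivacy

/-! ### The decorrelating channel -/

/-! Stage 1 keeps the user of a pair whose parameter `p` is farther from 1/2, and touches the other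
sample only when the kept one is in its less likely state. That sample is then thinned so that its
conditional law becomes the one given the likelier state, which makes the outputs independent
(`sum_pairMass_mul_keepFirst`). A sample is altered with probability min(p, 1-p) times the total
variation distance |Cov|/(p(1-p)) of the two conditional laws, that is |Cov|/max(p, 1-p)
(`sum_pairMass_mul_one_sub_stayProb`). Since `p` is the farther parameter, the denominator is the
maximum of all four numbers (`max_four_eq`).

Stage 2 uses that flipping with probability r multiplies 1-2q by 1-2r. The values of |1-2q| are cut
into cells of width 1/j², and each user is moved to the end of his cell nearer to 1/2. Users of one
cell on the same side of 1/2 then have exactly the same parameter (`flipped_flipSize_eq`), so no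
amount of data separates them. Flip probabilities stay below 1/j because a zone of size about 1/j
around 1/2 is left alone; a user whose parameter after stage 1 is not 1/2, which is almost sure,
leaves this zone as j grows. The other cells receive infinitely many users unaltered by stage 1, by
the second Borel–Cantelli lemma (`ae_infinite_kept`), so j may grow with n slowly enough for every
such cell to hold at least j of them (`exists_levels`).

For privacy, the observed sequences of different users are independent before the permutation, and
given them X_u(k) depends only on the samples at time k of u and of his associate v, through a
function φ (`IsStageParam.exists_condProb`). Mutual information is bounded by a chi-square
divergence (`sum_mul_log_bounds`). The adversary sees Z only up to permutations, and the law of Z is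
invariant under a permutation moving (u, v) onto any of M disjoint pairs with the same parameters.
Hence φ may be replaced by its average over the M pairs, whose variance is at most 1/M
(`chiSquare_permAvg_le`, `chiSquare_le`). So I ≤ 1/(M p_u(1-p_u)) for every m.

The noise levels follow from Chebyshev's inequality; the second obfuscation adds at most `a n`,
which tends to 0. -/

lemma bern_nonneg {p : ℝ} (hp : p ∈ Set.Icc (0 : ℝ) 1) (x : Bool) : 0 ≤ bern p x := by
  cases x <;> simp [bern, hp.1, hp.2]

lemma bern_pos {p : ℝ} (hp : p ∈ Set.Ioo (0 : ℝ) 1) (x : Bool) : 0 < bern p x := by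
  cases x <;> simp [bern, hp.1, hp.2]

lemma sum_bern (p : ℝ) : ∑ x, bern p x = 1 := by simp [bern]

/-- The covariance of a pair of Bernoulli variables. -/
def covar (p p' ρ : ℝ) : ℝ := ρ * √(p * (1 - p) * (p' * (1 - p')))

lemma covar_comm (p p' ρ : ℝ) : covar p p' ρ = covar p' p ρ := by
  simp only [covar, mul_comm]

lemma pairMass_comm (p p' ρ : ℝ) (x y : Bool) : pairMass p p' ρ x y = pairMass p' p ρ y x := by
  simp only [pairMass, eq_comm (a := x), mul_comm (bern p x), mul_comm (p * (1 - p))]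

lemma Feasible.symm {p p' ρ : ℝ} (h : Feasible p p' ρ) : Feasible p' p ρ := fun x y => by
  rw [pairMass_comm]; exact h y x

lemma sum_pairMass (p p' ρ : ℝ) (x : Bool) : ∑ y, pairMass p p' ρ x y = bern p x := by
  cases x <;> simp [pairMass, bern] <;> ring

lemma pairCov_eq (p p' ρ : ℝ) : pairCov p p' ρ = covar p p' ρ := by
  simp only [pairCov, pairExp, Fintype.sum_bool, val, pairMass, bern, covar]
  simp
  ring

/-- The likelier state of a Bernoulli variable. -/
def anchor (p : ℝ) : Bool := decide (1 / 2 ≤ p)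

lemma bern_anchor (p : ℝ) : bern p (anchor p) = max p (1 - p) := by
  unfold anchor bern
  by_cases h : 1 / 2 ≤ p
  · rw [max_eq_left (by linarith), decide_eq_true h]; simp
  · rw [max_eq_right (by linarith), decide_eq_false h]; simp

/-- Conditional mass function of the second variable of a pair, given the first one. -/
def condMass (p p' ρ : ℝ) (x y : Bool) : ℝ := pairMass p p' ρ x y / bern p x

/-- Probability that the second sample is left unchanged, when the first user is kept. -/
def stayProb (p p' ρ : ℝ) (x y : Bool) : ℝ :=
  if x = anchor p then 1
  -- Only the excess over the target law, the one given `anchor p`, is removed. The outer `max 0`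
  -- matters only for infeasible `ρ`, where it keeps this a probability.
  else max 0 (min 1 (condMass p p' ρ (anchor p) y / condMass p p' ρ x y))

lemma stayProb_mem (p p' ρ : ℝ) (x y : Bool) : stayProb p p' ρ x y ∈ Set.Icc (0 : ℝ) 1 := by
  unfold stayProb
  split_ifs <;> simp

/-- The channel that keeps the first sample and makes the second one independent of it. -/
def keepFirst (p p' ρ : ℝ) (x y z z' : Bool) : ℝ :=
  if z = x then (if z' = y then stayProb p p' ρ x y else 1 - stayProb p p' ρ x y) else 0

lemma keepFirst_nonneg (p p' ρ : ℝ) (x y z z' : Bool) : 0 ≤ keepFirst p p' ρ x y z z' := by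
  have := stayProb_mem p p' ρ x y
  unfold keepFirst
  split_ifs <;> linarith [this.1, this.2]

lemma sum_keepFirst (p p' ρ : ℝ) (x y : Bool) : ∑ z, ∑ z', keepFirst p p' ρ x y z z' = 1 := by
  cases x <;> cases y <;> simp [keepFirst]

section

variable {p p' ρ : ℝ} (hp : p ∈ Set.Ioo (0 : ℝ) 1) (hρ : Feasible p p' ρ)

include hp

lemma sum_condMass (x : Bool) : condMass p p' ρ x true + condMass p p' ρ x false = 1 := by
  have h := sum_pairMass p p' ρ x
  rw [Fintype.sum_bool] at h
  rw [condMass, condMass, ← add_div, h, div_self (bern_pos hp x).ne']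

lemma condMass_eq_bern (x y : Bool) :
    condMass p p' ρ x y = bern (condMass p p' ρ x true) y := by
  cases y
  · simp [bern, ← sum_condMass (p' := p') (ρ := ρ) hp x]
  · simp [bern]

lemma pairMass_eq_mul_condMass (x y : Bool) :
    pairMass p p' ρ x y = bern p x * condMass p p' ρ x y := by
  rw [condMass, mul_div_cancel₀ _ (bern_pos hp x).ne']

include hρ

lemma condMass_nonneg (x y : Bool) : 0 ≤ condMass p p' ρ x y :=
  div_nonneg (hρ x y) (bern_pos hp x).le

/-- What survives is the overlap of the two conditional laws, as in a maximal coupling. If the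
denominator of the quotient vanishes, so does the overlap. -/
lemma condMass_mul_stayProb {x : Bool} (hx : x ≠ anchor p) (y : Bool) :
    condMass p p' ρ x y * stayProb p p' ρ x y
      = min (condMass p p' ρ x y) (condMass p p' ρ (anchor p) y) := by
  have h1 := condMass_nonneg hp hρ x y
  have h2 := condMass_nonneg hp hρ (anchor p) y
  rw [stayProb, if_neg hx, max_eq_right (le_min zero_le_one (div_nonneg h2 h1))]
  rcases h1.eq_or_lt with h | h
  · rw [← h]; simp [h2]
  · rw [mul_min_of_nonneg _ _ h1, mul_one, mul_div_cancel₀ _ h.ne']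

/-- With two states, the excess of one conditional law over the other in one state equals its
deficit in the other state. The flipped excess therefore fills the deficit exactly. -/
lemma sum_pairMass_mul_keepFirst (z z' : Bool) :
    ∑ x, ∑ y, pairMass p p' ρ x y * keepFirst p p' ρ x y z z'
      = bern p z * condMass p p' ρ (anchor p) z' := by
  have key : ∑ y, pairMass p p' ρ z y *
      (if z' = y then stayProb p p' ρ z y else 1 - stayProb p p' ρ z y)
        = bern p z * condMass p p' ρ (anchor p) z' := by
    simp_rw [pairMass_eq_mul_condMass hp, mul_assoc, ← Finset.mul_sum]
    congr 1
    by_cases hz : z = anchor p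
    · simp [stayProb, hz]
    · have e := condMass_mul_stayProb hp hρ hz
      have s1 := sum_condMass (p' := p') (ρ := ρ) hp z
      have s2 := sum_condMass (p' := p') (ρ := ρ) hp (anchor p)
      have et := e true
      have ef := e false
      rcases le_total (condMass p p' ρ z true) (condMass p p' ρ (anchor p) true) with h | h
      · rw [min_eq_left h] at et
        rw [min_eq_right (by linarith)] at ef
        cases z'
        · simp [mul_sub, et, ef]
        · simp [mul_sub, et, ef]; linarith
      · rw [min_eq_right h] at et
        rw [min_eq_left (by linarith)] at ef
        cases z'
        · simp [mul_sub, et, ef]; linarith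
        · simp [mul_sub, et, ef]
  rw [← key, Finset.sum_eq_single z]
  · simp [keepFirst]
  · intro x _ hx
    simp [keepFirst, hx.symm]
  · simp

/-- Changes occur only when the kept sample is in its rarer state, with conditional probability
|Cov|/(p(1-p)), the distance of the two conditional laws. Multiplying by the probability of the
rarer state cancels that factor and leaves the likelier one in the denominator. -/
lemma sum_pairMass_mul_one_sub_stayProb :
    ∑ x, ∑ y, pairMass p p' ρ x y * (1 - stayProb p p' ρ x y)
      = |covar p p' ρ| / max p (1 - p) := by
  have hne : (!anchor p) ≠ anchor p := by simp
  have e := condMass_mul_stayProb hp hρ hne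
  have et := e true
  have ef := e false
  have s1 := sum_condMass (p' := p') (ρ := ρ) hp (!anchor p)
  have s2 := sum_condMass (p' := p') (ρ := ρ) hp (anchor p)
  have hsplit : ∀ f : Bool → ℝ, ∑ x, f x = f (anchor p) + f (!anchor p) := by
    intro f
    cases anchor p <;> simp [add_comm]
  rw [hsplit]
  have h0 : ∑ y, pairMass p p' ρ (anchor p) y * (1 - stayProb p p' ρ (anchor p) y) = 0 := by
    simp [stayProb]
  rw [h0, zero_add]
  have h1 : ∑ y, pairMass p p' ρ (!anchor p) y * (1 - stayProb p p' ρ (!anchor p) y)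
      = bern p (!anchor p) *
        |condMass p p' ρ (!anchor p) true - condMass p p' ρ (anchor p) true| := by
    simp_rw [pairMass_eq_mul_condMass hp, mul_assoc, ← Finset.mul_sum, mul_sub, mul_one]
    rw [Fintype.sum_bool, et, ef]
    congr 1
    rcases le_total (condMass p p' ρ (!anchor p) true) (condMass p p' ρ (anchor p) true)
      with h | h
    · rw [min_eq_left h, min_eq_right (by linarith), abs_of_nonpos (by linarith)]
      linarith
    · rw [min_eq_right h, min_eq_left (by linarith), abs_of_nonneg (by linarith)]
      linarith
  rw [h1, ← bern_anchor, ← abs_of_pos (bern_pos hp (!anchor p)), ← abs_mul,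
    ← abs_of_pos (bern_pos hp (anchor p)), ← abs_div]
  have a1 : p ≠ 0 := hp.1.ne'
  have a2 : 1 - p ≠ 0 := by have := hp.2; linarith
  unfold condMass pairMass
  rw [← covar]
  rcases anchor p
  · congr 1
    simp only [bern]
    simp
    field_simp
    ring
  · rw [← abs_neg]
    congr 1
    simp only [bern]
    simp
    field_simp
    ring

end

/-- Written this way the conditional mass is affine in `ρ` with nonzero slope for admissible
parameters, so it takes the value 1/2 for at most one `ρ`. -/
lemma condMass_true_eq {p p' ρ : ℝ} (hp : p ∈ Set.Ioo (0 : ℝ) 1) (x : Bool) :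
    condMass p p' ρ x true
      = p' + ρ * ((if x then 1 else -1) * √(p * (1 - p) * (p' * (1 - p'))) / bern p x) := by
  have := (bern_pos hp x).ne'
  unfold condMass pairMass
  rw [add_div, mul_div_assoc, mul_comm (bern p x), div_mul_cancel₀ _ this]
  cases x <;> simp [bern] <;> ring

/-- Stage 1 of the scheme: the user whose parameter is farther from `1 / 2` is kept. -/
def decorKernel (p p' ρ : ℝ) (x y z z' : Bool) : ℝ :=
  if |1 - 2 * p'| ≤ |1 - 2 * p| then keepFirst p p' ρ x y z z' else keepFirst p' p ρ y x z' z

lemma decorKernel_nonneg (p p' ρ : ℝ) (x y z z' : Bool) : 0 ≤ decorKernel p p' ρ x y z z' := by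
  unfold decorKernel
  split_ifs <;> exact keepFirst_nonneg ..

lemma sum_decorKernel (p p' ρ : ℝ) (x y : Bool) :
    ∑ z, ∑ z', decorKernel p p' ρ x y z z' = 1 := by
  unfold decorKernel
  split_ifs
  · exact sum_keepFirst ..
  · rw [Finset.sum_comm]; exact sum_keepFirst ..

/-- `decorKernel` as a channel. -/
def decorPMF (p p' ρ : ℝ) (s : Bool × Bool) : PMF (Bool × Bool) :=
  PMF.ofFintype (fun t => ENNReal.ofReal (decorKernel p p' ρ s.1 s.2 t.1 t.2)) <| by
    rw [← ENNReal.ofReal_sum_of_nonneg fun _ _ => decorKernel_nonneg .., Fintype.sum_prod_type,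
      sum_decorKernel, ENNReal.ofReal_one]

lemma decorPMF_toReal (p p' ρ : ℝ) (s t : Bool × Bool) :
    (decorPMF p p' ρ s t).toReal = decorKernel p p' ρ s.1 s.2 t.1 t.2 := by
  rw [decorPMF, PMF.ofFintype_apply, ENNReal.toReal_ofReal (decorKernel_nonneg ..)]

/-- Parameter of the first user of a pair after stage 1. -/
def outFst (p p' ρ : ℝ) : ℝ :=
  if |1 - 2 * p'| ≤ |1 - 2 * p| then p else condMass p' p ρ (anchor p') true

/-- Parameter of the second user of a pair after stage 1. -/
def outSnd (p p' ρ : ℝ) : ℝ :=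
  if |1 - 2 * p'| ≤ |1 - 2 * p| then condMass p p' ρ (anchor p) true else p'

lemma sum_pairMass_mul_decorKernel {p p' ρ : ℝ} (hp : p ∈ Set.Ioo (0 : ℝ) 1)
    (hp' : p' ∈ Set.Ioo (0 : ℝ) 1) (hρ : Feasible p p' ρ) (z z' : Bool) :
    ∑ x, ∑ y, pairMass p p' ρ x y * decorKernel p p' ρ x y z z'
      = bern (outFst p p' ρ) z * bern (outSnd p p' ρ) z' := by
  unfold decorKernel outFst outSnd
  split_ifs
  · rw [sum_pairMass_mul_keepFirst hp hρ, ← condMass_eq_bern hp]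
  · rw [Finset.sum_comm]
    simp_rw [pairMass_comm p p']
    rw [sum_pairMass_mul_keepFirst hp' hρ.symm, ← condMass_eq_bern hp', mul_comm]

lemma outFst_mem {p p' ρ : ℝ} (hp : p ∈ Set.Ioo (0 : ℝ) 1)
    (hp' : p' ∈ Set.Ioo (0 : ℝ) 1) (hρ : Feasible p p' ρ) :
    outFst p p' ρ ∈ Set.Icc (0 : ℝ) 1 := by
  unfold outFst
  split_ifs
  · exact ⟨hp.1.le, hp.2.le⟩
  · have h1 := condMass_nonneg hp' hρ.symm (anchor p') true
    have h2 := condMass_nonneg hp' hρ.symm (anchor p') false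
    have h3 := sum_condMass (p' := p) (ρ := ρ) hp' (anchor p')
    exact ⟨h1, by linarith⟩

lemma outSnd_mem {p p' ρ : ℝ} (hp : p ∈ Set.Ioo (0 : ℝ) 1)
    (hp' : p' ∈ Set.Ioo (0 : ℝ) 1) (hρ : Feasible p p' ρ) :
    outSnd p p' ρ ∈ Set.Icc (0 : ℝ) 1 := by
  unfold outSnd
  split_ifs
  · have h1 := condMass_nonneg hp hρ (anchor p) true
    have h2 := condMass_nonneg hp hρ (anchor p) false
    have h3 := sum_condMass (p' := p') (ρ := ρ) hp (anchor p)
    exact ⟨h1, by linarith⟩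
  · exact ⟨hp'.1.le, hp'.2.le⟩

lemma max_eq_abs (p : ℝ) : max p (1 - p) = (1 + |1 - 2 * p|) / 2 := by
  rw [max_def]
  split_ifs with h
  · rw [abs_of_nonneg (by linarith)]; ring
  · rw [abs_of_nonpos (by linarith)]; ring

/-- `max p (1 - p)` grows with the distance of `p` from 1/2. This is why keeping the farther user
yields the denominator of `pairNoiseBound`. -/
lemma max_four_eq {p p' : ℝ} (h : |1 - 2 * p'| ≤ |1 - 2 * p|) :
    max (max p p') (max (1 - p) (1 - p')) = max p (1 - p) := by
  rw [max_max_max_comm, max_eq_left]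
  rw [max_eq_abs, max_eq_abs]
  linarith

lemma max_four_eq' {p p' : ℝ} (h : |1 - 2 * p| ≤ |1 - 2 * p'|) :
    max (max p p') (max (1 - p) (1 - p')) = max p' (1 - p') := by
  rw [max_comm p, max_comm (1 - p), max_four_eq h]

lemma pairNoiseBound_nonneg {p p' ρ : ℝ} (hp : p ∈ Set.Ioo (0 : ℝ) 1) :
    0 ≤ pairNoiseBound p p' ρ :=
  div_nonneg (abs_nonneg _) (le_max_of_le_left (le_max_of_le_left hp.1.le))

lemma sum_keepFirst_ne_fst (p p' ρ : ℝ) (x y : Bool) :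
    ∑ z, ∑ z', keepFirst p p' ρ x y z z' * (if z ≠ x then 1 else 0) = 0 := by
  cases x <;> cases y <;> simp [keepFirst]

lemma sum_keepFirst_ne_snd (p p' ρ : ℝ) (x y : Bool) :
    ∑ z, ∑ z', keepFirst p p' ρ x y z z' * (if z' ≠ y then 1 else 0)
      = 1 - stayProb p p' ρ x y := by
  cases x <;> cases y <;> simp [keepFirst]

lemma noise_fst_le {p p' ρ : ℝ} (hp : p ∈ Set.Ioo (0 : ℝ) 1)
    (hp' : p' ∈ Set.Ioo (0 : ℝ) 1) (hρ : Feasible p p' ρ) :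
    ∑ x, ∑ y, pairMass p p' ρ x y *
      (∑ z, ∑ z', decorKernel p p' ρ x y z z' * (if z ≠ x then 1 else 0))
        ≤ pairNoiseBound p p' ρ := by
  unfold decorKernel
  split_ifs with h
  · simp_rw [sum_keepFirst_ne_fst]
    simpa using pairNoiseBound_nonneg hp
  · rw [pairNoiseBound, max_four_eq' (not_le.1 h).le, pairCov_eq, covar_comm,
      ← sum_pairMass_mul_one_sub_stayProb hp' hρ.symm, Finset.sum_comm]
    refine (Finset.sum_congr rfl fun y _ => Finset.sum_congr rfl fun x _ => ?_).le
    rw [pairMass_comm, Finset.sum_comm, sum_keepFirst_ne_snd]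

lemma noise_snd_le {p p' ρ : ℝ} (hp : p ∈ Set.Ioo (0 : ℝ) 1) (hρ : Feasible p p' ρ) :
    ∑ x, ∑ y, pairMass p p' ρ x y *
      (∑ z, ∑ z', decorKernel p p' ρ x y z z' * (if z' ≠ y then 1 else 0))
        ≤ pairNoiseBound p p' ρ := by
  unfold decorKernel
  split_ifs with h
  · rw [pairNoiseBound, max_four_eq h, pairCov_eq,
      ← sum_pairMass_mul_one_sub_stayProb hp hρ]
    refine (Finset.sum_congr rfl fun x _ => Finset.sum_congr rfl fun y _ => ?_).le
    rw [sum_keepFirst_ne_snd]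
  · have : ∀ x y, ∑ z, ∑ z', keepFirst p' p ρ y x z' z * (if z' ≠ y then 1 else 0) = 0 := by
      intro x y
      rw [Finset.sum_comm, sum_keepFirst_ne_fst]
    simp_rw [this]
    simpa using pairNoiseBound_nonneg hp

/-! ### Sums over configurations that factor over groups of size at most two -/

/-- The points of `I` and the two ends of each pair in `E`. -/
def pairingMap {ι : Type*} (I : Finset ι) (E : Finset (ι × ι)) : I ⊕ (E × Bool) → ι :=
  Sum.elim (fun i => i.1) fun e => if e.2 then e.1.1.1 else e.1.1.2

/-- The points of `I` and the pairs in `E` partition the whole type. -/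
def IsPairing {ι : Type*} (I : Finset ι) (E : Finset (ι × ι)) : Prop :=
  Function.Bijective (pairingMap I E)

section

variable {ι β : Type*} [Fintype ι] {I : Finset ι} {E : Finset (ι × ι)}

lemma IsPairing.prod_eq (h : IsPairing I E) (g : ι → ℝ) :
    ∏ w, g w = (∏ u ∈ I, g u) * ∏ e ∈ E, (g e.1 * g e.2) := by
  rw [← (Equiv.ofBijective _ h).prod_comp, Fintype.prod_sum_type, Fintype.prod_prod_type]
  congr 1
  · exact Finset.prod_coe_sort I g
  · simp only [Fintype.prod_bool]
    exact Finset.prod_coe_sort E fun e => g e.1 * g e.2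

/-- Distributivity: a configuration is an independent choice of values on the points of `I` and of
pairs of values on the elements of `E`. -/
lemma IsPairing.sum_prod_eq [DecidableEq ι] [Fintype β] (h : IsPairing I E)
    (A : ι → β → ℝ) (B : ι × ι → β → β → ℝ) :
    ∑ x : ι → β, (∏ u ∈ I, A u (x u)) * ∏ e ∈ E, B e (x e.1) (x e.2)
      = (∏ u ∈ I, ∑ b, A u b) * ∏ e ∈ E, ∑ b, ∑ c, B e b c := by
  classical
  let φ : ((I → β) × (E → β × β)) ≃ (ι → β) :=
    ((Equiv.refl (I → β)).prodCongr
      ((Equiv.arrowCongr (Equiv.refl E) (Equiv.boolArrowEquivProd β).symm).trans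
        (Equiv.curry E Bool β).symm)).trans
      ((Equiv.sumArrowEquivProdArrow I (E × Bool) β).symm.trans
        (Equiv.arrowCongr (Equiv.ofBijective _ h) (Equiv.refl β)))
  -- `boolArrowEquivProd` lists the value at `false` first, whereas `true` marks the first end of a
  -- pair in `pairingMap`. Hence the first end carries the second component.
  have hφ : ∀ y v, φ y (Equiv.ofBijective _ h v) = Sum.elim y.1
      (fun e : E × Bool => if e.2 then (y.2 e.1).2 else (y.2 e.1).1) v := by
    rintro y (i | ⟨e, b⟩)
    · simp only [φ, Equiv.trans_apply, Equiv.arrowCongr_apply, Function.comp,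
        Equiv.symm_apply_apply]
      rfl
    · simp only [φ, Equiv.trans_apply, Equiv.arrowCongr_apply, Function.comp,
        Equiv.symm_apply_apply]
      cases b <;> rfl
  have h1 : ∀ y (i : I), φ y i = y.1 i := fun y i => hφ y (Sum.inl i)
  have h2 : ∀ y (e : E), φ y e.1.1 = (y.2 e).2 := fun y e => hφ y (Sum.inr (e, true))
  have h3 : ∀ y (e : E), φ y e.1.2 = (y.2 e).1 := fun y e => hφ y (Sum.inr (e, false))
  rw [← φ.sum_comp, Fintype.sum_prod_type]
  simp_rw [← Finset.prod_coe_sort I, ← Finset.prod_coe_sort E, h1, h2, h3]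
  rw [← Finset.sum_mul_sum]
  congr 1
  · rw [Finset.prod_univ_sum, Fintype.piFinset_univ]
  · have : ∀ e : E, ∑ b, ∑ c, B e b c = ∑ y : β × β, B e y.2 y.1 := fun e => by
      rw [Fintype.sum_prod_type_right]
    simp_rw [this]
    rw [Finset.prod_univ_sum, Fintype.piFinset_univ]

end

/-! ### The one-step law -/

/-- The graph is a partial matching; the bound on the components is only ever used in this form. -/
lemma adj_unique {G : SimpleGraph ℕ} (hG : ∀ c : G.ConnectedComponent, c.supp.encard ≤ 2)
    {u v w : ℕ} (hv : G.Adj u v) (hw : G.Adj u w) : v = w := by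
  by_contra hne
  have hsub : ({u, v, w} : Set ℕ) ⊆ (G.connectedComponentMk u).supp := by
    rintro x (rfl | rfl | rfl)
    · rfl
    · exact SimpleGraph.ConnectedComponent.eq.2 hv.reachable.symm
    · exact SimpleGraph.ConnectedComponent.eq.2 hw.reachable.symm
  have h3 : ({u, v, w} : Set ℕ).encard = 3 := by
    rw [Set.encard_insert_of_notMem, Set.encard_pair hne]
    · norm_num
    · simp [hv.ne, hw.ne]
  have := (Set.encard_le_encard hsub).trans (hG _)
  rw [h3] at this
  exact absurd this (by decide)

open scoped Classical in
lemma mem_isolated {G : SimpleGraph ℕ} {n : ℕ} {u : Fin n} :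
    u ∈ isolated G n ↔ ∀ v : Fin n, ¬ G.Adj u v := by
  unfold isolated
  exact Finset.mem_filter.trans (and_iff_right (Finset.mem_univ _))

lemma mem_edges {G : SimpleGraph ℕ} {n : ℕ} {e : Fin n × Fin n} :
    e ∈ edges G n ↔ e.1 < e.2 ∧ G.Adj e.1 e.2 := by
  simp [edges]

lemma isPairing_edges {G : SimpleGraph ℕ} (hG : ∀ c : G.ConnectedComponent, c.supp.encard ≤ 2)
    (n : ℕ) : IsPairing (isolated G n) (edges G n) := by
  constructor
  · rintro (⟨i, hi⟩ | ⟨⟨⟨a, b⟩, he⟩, s⟩) (⟨j, hj⟩ | ⟨⟨⟨c, d⟩, hf⟩, t⟩) h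
    · simp only [pairingMap, Sum.elim_inl] at h
      simp [h]
    · rw [mem_isolated] at hi
      rw [mem_edges] at hf
      cases t <;> simp only [pairingMap, Sum.elim_inl, Sum.elim_inr] at h <;> subst h
      · exact absurd hf.2.symm (hi _)
      · exact absurd hf.2 (hi _)
    · rw [mem_isolated] at hj
      rw [mem_edges] at he
      cases s <;> simp only [pairingMap, Sum.elim_inl, Sum.elim_inr] at h <;> subst h
      · exact absurd he.2.symm (hj _)
      · exact absurd he.2 (hj _)
    · rw [mem_edges] at he hf
      obtain ⟨h1, h2⟩ := he
      obtain ⟨h3, h4⟩ := hf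
      simp only at h1 h2 h3 h4
      cases s <;> cases t <;> simp [pairingMap] at h <;> subst h
      · have := Fin.ext (adj_unique hG h2.symm h4.symm)
        subst this; rfl
      · have := Fin.ext (adj_unique hG h2.symm h4)
        subst this
        exact absurd h1 h3.asymm
      · have := Fin.ext (adj_unique hG h2 h4.symm)
        subst this
        exact absurd h1 h3.asymm
      · have := Fin.ext (adj_unique hG h2 h4)
        subst this; rfl
  · intro u
    by_cases hu : u ∈ isolated G n
    · exact ⟨Sum.inl ⟨u, hu⟩, rfl⟩
    · rw [mem_isolated] at hu
      push Not at hu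
      obtain ⟨v, hv⟩ := hu
      rcases lt_trichotomy u v with h | h | h
      · exact ⟨Sum.inr (⟨(u, v), mem_edges.2 ⟨h, hv⟩⟩, true), rfl⟩
      · subst h; exact absurd hv (G.loopless.irrefl _)
      · exact ⟨Sum.inr (⟨(v, u), mem_edges.2 ⟨h, hv.symm⟩⟩, false), rfl⟩

/-- Expectation of `h (X, S)`, where `S` is the sample after stage 1, for an isolated user. -/
def isoExp (p : ℝ) (h : Bool → Bool → ℝ) : ℝ := ∑ x, bern p x * h x x

/-- Expectation of `h (X, S) * h' (X', S')`, where `S`, `S'` are the samples after stage 1, for an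
associated pair. -/
def stageExp (S : Scheme) (p p' ρ : ℝ) (h h' : Bool → Bool → ℝ) : ℝ :=
  ∑ x, ∑ y, pairMass p p' ρ x y *
    ∑ z, ∑ z', (S.decor p p' ρ (x, y) (z, z')).toReal * (h x z * h' y z')

/-- Expectation of a function of the data of all users before and after stage 1. -/
def stepExp (S : Scheme) (G : SimpleGraph ℕ) (p : ℕ → ℝ) (ρ : ℕ × ℕ → ℝ) (n : ℕ)
    (F : (Fin n → Bool) → (Fin n → Bool) → ℝ) : ℝ :=
  ∑ x, ∑ s, dataMass G p ρ n x * S.stageOneMass G p ρ n x s * F x s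

lemma stageOneMass_eq (S : Scheme) (G : SimpleGraph ℕ) (p : ℕ → ℝ) (ρ : ℕ × ℕ → ℝ) (n : ℕ)
    (x z : Fin n → Bool) :
    S.stageOneMass G p ρ n x z = (∏ u ∈ isolated G n, if z u = x u then 1 else 0) *
      ∏ e ∈ edges G n,
        (S.decor (p e.1) (p e.2) (ρ (e.1, e.2)) (x e.1, x e.2) (z e.1, z e.2)).toReal := by
  unfold Scheme.stageOneMass
  congr!

/-- All computations at one time reduce to this one: the expectation of a product over users splits
over isolated users and pairs, so that it suffices to know the factor of each group. -/
lemma stepExp_prod (S : Scheme) {G : SimpleGraph ℕ}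
    (hG : ∀ c : G.ConnectedComponent, c.supp.encard ≤ 2) (p : ℕ → ℝ) (ρ : ℕ × ℕ → ℝ) (n : ℕ)
    (h : Fin n → Bool → Bool → ℝ) (H : Fin n → ℝ)
    (hI : ∀ u ∈ isolated G n, isoExp (p u) (h u) = H u)
    (hE : ∀ e ∈ edges G n,
      stageExp S (p e.1) (p e.2) (ρ (e.1, e.2)) (h e.1) (h e.2) = H e.1 * H e.2) :
    stepExp S G p ρ n (fun x s => ∏ w, h w (x w) (s w)) = ∏ w, H w := by
  classical
  have hpair := isPairing_edges hG n
  let A : Fin n → Bool × Bool → ℝ := fun u b =>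
    bern (p u) b.1 * ((if b.2 = b.1 then 1 else 0) * h u b.1 b.2)
  let B : Fin n × Fin n → Bool × Bool → Bool × Bool → ℝ := fun e b c =>
    pairMass (p e.1) (p e.2) (ρ (e.1, e.2)) b.1 c.1 *
      ((S.decor (p e.1) (p e.2) (ρ (e.1, e.2)) (b.1, c.1) (b.2, c.2)).toReal *
        (h e.1 b.1 b.2 * h e.2 c.1 c.2))
  have h1 : stepExp S G p ρ n (fun x s => ∏ w, h w (x w) (s w))
      = ∑ t : Fin n → Bool × Bool, (∏ u ∈ isolated G n, A u (t u)) *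
          ∏ e ∈ edges G n, B e (t e.1) (t e.2) := by
    rw [stepExp, ← Fintype.sum_prod_type', ← (Equiv.arrowProdEquivProdArrow (Fin n)
      (fun _ => Bool) (fun _ => Bool)).sum_comp]
    refine Finset.sum_congr rfl fun t _ => ?_
    rw [hpair.prod_eq]
    simp only [A, B, dataMass, stageOneMass_eq, Equiv.arrowProdEquivProdArrow,
      Equiv.coe_fn_mk, Finset.prod_mul_distrib]
    ring
  rw [h1, hpair.sum_prod_eq, hpair.prod_eq]
  congr 1
  · refine Finset.prod_congr rfl fun u hu => ?_
    rw [← hI u hu, isoExp, Fintype.sum_prod_type]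
    simp [A]
  · refine Finset.prod_congr rfl fun e he => ?_
    rw [← hE e he, stageExp]
    simp only [B, Fintype.sum_prod_type]
    simp only [Fintype.sum_bool]
    ring

/-! ### The one-step law, as a measure -/

section

variable {S : Scheme} {G : SimpleGraph ℕ} {p : ℕ → ℝ} {ρ : ℕ × ℕ → ℝ} {n : ℕ}

/-- The parameters of all users and pairs are admissible. -/
structure Admissible (G : SimpleGraph ℕ) (p : ℕ → ℝ) (ρ : ℕ × ℕ → ℝ) : Prop where
  mem : ∀ u, p u ∈ Set.Ioo (0 : ℝ) 1
  feasible : ∀ u v, u < v → G.Adj u v → Feasible (p u) (p v) (ρ (u, v))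

lemma dataMass_nonneg (h : Admissible G p ρ) (x : Fin n → Bool) : 0 ≤ dataMass G p ρ n x :=
  mul_nonneg (Finset.prod_nonneg fun u _ => (bern_pos (h.mem u) _).le)
    (Finset.prod_nonneg fun _ he =>
      h.feasible _ _ (mem_edges.1 he).1 (mem_edges.1 he).2 _ _)

lemma stageOneMass_nonneg (S : Scheme) (x z : Fin n → Bool) : 0 ≤ S.stageOneMass G p ρ n x z :=
  mul_nonneg (Finset.prod_nonneg fun u _ => by split_ifs <;> simp)
    (Finset.prod_nonneg fun _ _ => ENNReal.toReal_nonneg)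

lemma lintegral_stepLaw (h : Admissible G p ρ) (F : (Fin n → Bool) → (Fin n → Bool) → ℝ)
    (hF : ∀ x s, 0 ≤ F x s) :
    ∫⁻ t, ENNReal.ofReal (F t.1 t.2) ∂(S.stepLaw G p ρ n)
      = ENNReal.ofReal (stepExp S G p ρ n F) := by
  have hm : ∀ x s, 0 ≤ dataMass G p ρ n x * S.stageOneMass G p ρ n x s := fun x s =>
    mul_nonneg (dataMass_nonneg h x) (stageOneMass_nonneg S x s)
  rw [Scheme.stepLaw, stepExp, lintegral_finsetSum_measure,
    ENNReal.ofReal_sum_of_nonneg fun x _ => Finset.sum_nonneg fun s _ =>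
      mul_nonneg (hm x s) (hF x s)]
  refine Finset.sum_congr rfl fun x _ => ?_
  rw [lintegral_finsetSum_measure,
    ENNReal.ofReal_sum_of_nonneg fun s _ => mul_nonneg (hm x s) (hF x s)]
  refine Finset.sum_congr rfl fun s _ => ?_
  rw [lintegral_smul_measure, lintegral_dirac, smul_eq_mul, ENNReal.ofReal_mul (hm x s)]

open scoped Classical in
lemma stepLaw_apply (h : Admissible G p ρ) (A : Set ((Fin n → Bool) × (Fin n → Bool))) :
    S.stepLaw G p ρ n A
      = ENNReal.ofReal (stepExp S G p ρ n fun x s => if (x, s) ∈ A then 1 else 0) := by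
  rw [← lintegral_stepLaw h _ (fun x s => by split_ifs <;> simp),
    ← lintegral_indicator_one (MeasurableSet.of_discrete)]
  congr 1 with t
  by_cases ht : t ∈ A <;> simp [ht]

lemma stepExp_nonneg (h : Admissible G p ρ) {F : (Fin n → Bool) → (Fin n → Bool) → ℝ}
    (hF : ∀ x s, 0 ≤ F x s) : 0 ≤ stepExp S G p ρ n F :=
  Finset.sum_nonneg fun x _ => Finset.sum_nonneg fun s _ => mul_nonneg
    (mul_nonneg (dataMass_nonneg h x) (stageOneMass_nonneg S x s)) (hF x s)

end

/-! ### Expectations over a single group of users -/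

section

variable (S : Scheme) {p p' ρ q q' : ℝ}

lemma isoExp_const_one (p : ℝ) : isoExp p (fun _ _ => 1) = 1 := by
  simp [isoExp, bern]

lemma isoExp_stage (p : ℝ) (g : Bool → ℝ) : isoExp p (fun _ s => g s) = ∑ s, bern p s * g s := rfl

/-- Summing out the data leaves the output law of the pair, which is a product law by `hd`. -/
lemma stageExp_stage
    (hd : ∀ z z' : Bool,
      pairExp p p' ρ (fun x y => (S.decor p p' ρ (x, y) (z, z')).toReal) = bern q z * bern q' z')
    (g g' : Bool → ℝ) :
    stageExp S p p' ρ (fun _ s => g s) (fun _ s => g' s)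
      = (∑ s, bern q s * g s) * ∑ s, bern q' s * g' s := by
  have h1 := hd true true
  have h2 := hd true false
  have h3 := hd false true
  have h4 := hd false false
  simp only [pairExp, stageExp, Fintype.sum_bool] at *
  linear_combination (g true * g' true) * h1 + (g true * g' false) * h2 +
    (g false * g' true) * h3 + (g false * g' false) * h4

lemma sum_decor (x y : Bool) :
    ∑ z, ∑ z', (S.decor p p' ρ (x, y) (z, z')).toReal = 1 := by
  have := (S.decor p p' ρ (x, y)).tsum_coe
  rw [tsum_fintype, Fintype.sum_prod_type] at this
  have h2 := congrArg ENNReal.toReal this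
  rw [ENNReal.toReal_sum (fun _ _ => ENNReal.sum_ne_top.2 fun _ _ => PMF.apply_ne_top _ _)] at h2
  simp_rw [ENNReal.toReal_sum (fun (_ : Bool) _ => PMF.apply_ne_top (S.decor p p' ρ (x, y)) _)]
    at h2
  simpa using h2

lemma stageExp_data_fst (g : Bool → ℝ) :
    stageExp S p p' ρ (fun x _ => g x) (fun _ _ => 1) = ∑ x, bern p x * g x := by
  unfold stageExp
  simp_rw [mul_one, ← Finset.sum_mul, sum_decor, one_mul, ← Finset.sum_mul, sum_pairMass]

lemma stageExp_data_snd (g : Bool → ℝ) :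
    stageExp S p p' ρ (fun _ _ => 1) (fun y _ => g y) = ∑ y, bern p' y * g y := by
  unfold stageExp
  simp_rw [one_mul, ← Finset.sum_mul, sum_decor, one_mul]
  rw [Finset.sum_comm]
  simp_rw [← Finset.sum_mul, pairMass_comm p p', sum_pairMass]

/-- It bounds the joint mass of an event and the observations by the mass of the observations, which
makes their quotient a number in [0,1] in `IsStageParam.exists_condProb`. -/
lemma stageExp_mono (hρ : Feasible p p' ρ) {h h' k k' : Bool → Bool → ℝ}
    (h0 : ∀ x s, 0 ≤ h x s) (h0' : ∀ x s, 0 ≤ h' x s) (hk : ∀ x s, h x s ≤ k x s)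
    (hk' : ∀ x s, h' x s ≤ k' x s) :
    stageExp S p p' ρ h h' ≤ stageExp S p p' ρ k k' := by
  unfold stageExp
  gcongr with x _ y _ z _ z' _
  · exact hρ x y
  · exact h0' _ _
  · exact (h0 _ _).trans (hk _ _)
  · exact hk _ _
  · exact hk' _ _

lemma stageExp_nonneg (hρ : Feasible p p' ρ) {h h' : Bool → Bool → ℝ}
    (h0 : ∀ x s, 0 ≤ h x s) (h0' : ∀ x s, 0 ≤ h' x s) :
    0 ≤ stageExp S p p' ρ h h' :=
  Finset.sum_nonneg fun x _ => Finset.sum_nonneg fun y _ => mul_nonneg (hρ x y) <|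
    Finset.sum_nonneg fun _ _ => Finset.sum_nonneg fun _ _ =>
      mul_nonneg ENNReal.toReal_nonneg (mul_nonneg (h0 _ _) (h0' _ _))

end

/-! ### The law of data, obfuscated data and permutation -/

section

variable {S : Scheme} {G : SimpleGraph ℕ} {p : ℕ → ℝ} {ρ : ℕ × ℕ → ℝ} {n m : ℕ}

lemma isProbabilityMeasure_stepLaw (S : Scheme) (n : ℕ)
    (hG : ∀ c : G.ConnectedComponent, c.supp.encard ≤ 2) (h : Admissible G p ρ) :
    IsProbabilityMeasure (S.stepLaw G p ρ n) := by
  constructor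
  rw [stepLaw_apply h]
  have := stepExp_prod S hG p ρ n (fun _ _ _ => 1) (fun _ => 1)
    (fun u _ => isoExp_const_one _)
    (fun e _ => by
      rw [stageExp_data_fst S (fun _ => 1)]
      simp [bern])
  simp only [Finset.prod_const_one] at this
  simp [this]

open scoped Classical in
/-- Stage 2 at one time, for given flip probabilities and given uniform variables. -/
def flipMap (r : Fin n → ℝ) (t : ((Fin n → Bool) × (Fin n → Bool)) × (Fin n → unitInterval)) :
    (Fin n → Bool) × (Fin n → Bool) :=
  (t.1.1, fun u => if (t.2 u : ℝ) < r u then !(t.1.2 u) else t.1.2 u)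

lemma measurable_flipMap (r : Fin n → ℝ) : Measurable (flipMap r) := by
  refine Measurable.prodMk (by fun_prop) (measurable_pi_iff.2 fun u => ?_)
  refine Measurable.ite ?_ ?_ ?_
  · exact measurableSet_lt (by fun_prop) (by fun_prop)
  · exact (measurable_of_finite not).comp (by fun_prop)
  · fun_prop

/-- Joint law, at one time, of the data and the obfuscated data of all users, for given flip
probabilities. -/
def obsLaw (S : Scheme) (G : SimpleGraph ℕ) (p : ℕ → ℝ) (ρ : ℕ × ℕ → ℝ) (n : ℕ)
    (r : Fin n → ℝ) : Measure ((Fin n → Bool) × (Fin n → Bool)) :=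
  ((S.stepLaw G p ρ n).prod (Measure.pi fun _ : Fin n => (volume : Measure unitInterval))).map
    (flipMap r)

/-- Data and obfuscated data at all times, and the permutation. -/
def observe (ω : Sample n m) :
    (Fin m → (Fin n → Bool) × (Fin n → Bool)) × Equiv.Perm (Fin n) :=
  (fun k => (dataX ω k, dataZ ω k), ω.2.2.2)

lemma measurable_observe : Measurable (observe : Sample n m → _) := by
  refine Measurable.prodMk (measurable_pi_iff.2 fun k => ?_) (by fun_prop)
  refine Measurable.prodMk (by unfold dataX; fun_prop) (measurable_pi_iff.2 fun u => ?_)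
  unfold dataZ stageOne
  refine Measurable.ite ?_ ?_ ?_
  · exact measurableSet_lt (by fun_prop) (by fun_prop)
  · exact (measurable_of_finite not).comp (by fun_prop)
  · fun_prop

/-- A flip probability drawn once would correlate the times in general. When its law is a Dirac
mass, the step at time `k` uses only the data and the uniform variables of time `k`, so regrouping
the product by times gives i.i.d. steps. -/
lemma map_observe_law [IsProbabilityMeasure (S.stepLaw G p ρ n)] {r : Fin n → ℝ}
    (hr : ∀ u, S.flipLaw n (S.outParam G p ρ n u) = Measure.dirac (r u)) :
    (S.law G p ρ n m).map observe
      = (Measure.pi fun _ : Fin m => obsLaw S G p ρ n r).prod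
          (PMF.uniformOfFintype (Equiv.Perm (Fin n))).toMeasure := by
  have hD : (Measure.pi fun u : Fin n => S.flipLaw n (S.outParam G p ρ n u))
      = Measure.dirac r := by
    simp_rw [hr]
    rw [← Measure.infinitePi_eq_pi, Measure.infinitePi_dirac]
  rw [Scheme.law, hD]
  set A := Measure.pi fun _ : Fin m => S.stepLaw G p ρ n with hA
  set B := Measure.pi fun _ : Fin m => Measure.pi fun _ : Fin n =>
    (volume : Measure unitInterval) with hB
  set U := (PMF.uniformOfFintype (Equiv.Perm (Fin n))).toMeasure with hU
  have h1 : A.prod ((Measure.dirac r).prod (B.prod U))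
      = (A.prod (B.prod U)).map (Prod.map id (Prod.mk r)) := by
    rw [← Measure.map_prod_map _ _ measurable_id measurable_prodMk_left, Measure.map_id,
      Measure.dirac_prod]
  have h2 : A.prod B = (Measure.pi fun _ : Fin m => (S.stepLaw G p ρ n).prod
      (Measure.pi fun _ : Fin n => (volume : Measure unitInterval))).map
        (MeasurableEquiv.arrowProdEquivProdArrow _ _ (Fin m)) :=
    (measurePreserving_arrowProdEquivProdArrow _ _ (Fin m) (fun _ => S.stepLaw G p ρ n)
      (fun _ => Measure.pi fun _ : Fin n => (volume : Measure unitInterval))).map_eq.symm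
  let Ψ : (Fin m → (Fin n → Bool) × (Fin n → Bool)) × (Fin m → Fin n → unitInterval) →
      (Fin m → (Fin n → Bool) × (Fin n → Bool)) := fun t k => flipMap r (t.1 k, t.2 k)
  have hΨ : Measurable Ψ := measurable_pi_iff.2 fun k =>
    (measurable_flipMap r).comp (by fun_prop)
  have h3 : (A.prod B).map Ψ = Measure.pi fun _ : Fin m => obsLaw S G p ρ n r := by
    rw [h2, Measure.map_map hΨ (MeasurableEquiv.measurable _)]
    have : IsProbabilityMeasure (obsLaw S G p ρ n r) :=
      Measure.isProbabilityMeasure_map (measurable_flipMap r).aemeasurable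
    exact Measure.pi_map_pi (hμ := fun _ => by
      change SigmaFinite (obsLaw S G p ρ n r); infer_instance)
      (fun _ => (measurable_flipMap r).aemeasurable)
  rw [h1, Measure.map_map measurable_observe (by fun_prop), ← h3, ← Measure.prodAssoc_prod,
    Measure.map_map (measurable_observe.comp (by fun_prop)) (MeasurableEquiv.measurable _)]
  conv_rhs => rw [← Measure.map_id (μ := U)]
  rw [Measure.map_prod_map _ _ hΨ measurable_id]
  rfl

lemma isProbabilityMeasure_obsLaw [IsProbabilityMeasure (S.stepLaw G p ρ n)] (r : Fin n → ℝ) :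
    IsProbabilityMeasure (obsLaw S G p ρ n r) :=
  Measure.isProbabilityMeasure_map (measurable_flipMap r).aemeasurable

/-! ### Values of the law of the obfuscated data at one time -/

/-- Transition probabilities of the binary symmetric channel with error probability `r`. -/
def flipMass (r : ℝ) (z s : Bool) : ℝ := if z = s then 1 - r else r

lemma flipMass_nonneg {r : ℝ} (hr : r ∈ Set.Icc (0 : ℝ) 1) (z s : Bool) : 0 ≤ flipMass r z s := by
  unfold flipMass
  split_ifs <;> linarith [hr.1, hr.2]

/-- Parameter of a Bernoulli variable with parameter `q` after flipping with probability `r`. -/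
def flipped (q r : ℝ) : ℝ := q + (1 - 2 * q) * r

lemma sum_bern_mul_flipMass (q r : ℝ) (z : Bool) :
    ∑ s, bern q s * flipMass r z s = bern (flipped q r) z := by
  cases z <;> simp [bern, flipMass, flipped] <;> ring

lemma flipped_mem {q r : ℝ} (hq : q ∈ Set.Icc (0 : ℝ) 1) (hr : r ∈ Set.Icc (0 : ℝ) 1) :
    flipped q r ∈ Set.Icc (0 : ℝ) 1 := by
  obtain ⟨h1, h2⟩ := hq
  obtain ⟨h3, h4⟩ := hr
  unfold flipped
  constructor <;> nlinarith

lemma volume_flip {r : ℝ} (hr : r ∈ Set.Icc (0 : ℝ) 1) (z s : Bool) :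
    volume {t : unitInterval | (if (t : ℝ) < r then !s else s) = z}
      = ENNReal.ofReal (flipMass r z s) := by
  unfold flipMass
  by_cases h : z = s
  · have : {t : unitInterval | (if (t : ℝ) < r then !s else s) = z}
        = Set.Ici (⟨r, hr⟩ : unitInterval) := by
      ext t
      subst h
      simp [← Subtype.coe_le_coe]
    rw [this, unitInterval.volume_Ici, if_pos h]
  · have : {t : unitInterval | (if (t : ℝ) < r then !s else s) = z}
        = Set.Iio (⟨r, hr⟩ : unitInterval) := by
      ext t
      have hz : z = !s := by cases z <;> cases s <;> simp_all
      subst hz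
      simp [← Subtype.coe_lt_coe]
    rw [this, unitInterval.volume_Iio, if_neg h]

open scoped Classical in
lemma obsLaw_apply (h : Admissible G p ρ) {r : Fin n → ℝ}
    (hr : ∀ u, r u ∈ Set.Icc (0 : ℝ) 1) (P : (Fin n → Bool) → Prop) (z : Fin n → Bool) :
    obsLaw S G p ρ n r {t | P t.1 ∧ t.2 = z}
      = ENNReal.ofReal (stepExp S G p ρ n fun x s =>
          (if P x then 1 else 0) * ∏ w, flipMass (r w) (z w) (s w)) := by
  have hnn : ∀ x s : Fin n → Bool,
      0 ≤ (if P x then 1 else 0) * ∏ w, flipMass (r w) (z w) (s w) := fun x s =>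
    mul_nonneg (by split_ifs <;> simp) (Finset.prod_nonneg fun w _ => flipMass_nonneg (hr w) _ _)
  rw [obsLaw, Measure.map_apply (measurable_flipMap r) MeasurableSet.of_discrete,
    Measure.prod_apply (measurable_flipMap r MeasurableSet.of_discrete),
    ← lintegral_stepLaw h _ hnn]
  congr 1 with t
  by_cases hP : P t.1
  · have : Prod.mk t ⁻¹' (flipMap r ⁻¹' {t | P t.1 ∧ t.2 = z})
        = Set.univ.pi fun w => {τ : unitInterval |
          (if (τ : ℝ) < r w then !(t.2 w) else t.2 w) = z w} := by
      ext τ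
      simp only [Set.mem_preimage, Set.mem_ofPred_eq, flipMap, hP, true_and, Set.mem_univ_pi,
        funext_iff]
    rw [this, Measure.pi_pi, if_pos hP, one_mul,
      ENNReal.ofReal_prod_of_nonneg fun w _ => flipMass_nonneg (hr w) _ _]
    exact Finset.prod_congr rfl fun w _ => volume_flip (hr w) _ _
  · have : Prod.mk t ⁻¹' (flipMap r ⁻¹' {t | P t.1 ∧ t.2 = z}) = ∅ := by
      ext τ
      simp [flipMap, hP]
    rw [this]
    simp [hP]

lemma obsLaw_ne_le [IsProbabilityMeasure (S.stepLaw G p ρ n)] {r : Fin n → ℝ}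
    (hr : ∀ u, r u ∈ Set.Icc (0 : ℝ) 1) (u : Fin n) :
    (obsLaw S G p ρ n r).real {t | t.2 u ≠ t.1 u}
      ≤ (S.stepLaw G p ρ n).real {t | t.2 u ≠ t.1 u} + r u := by
  have hsub : flipMap r ⁻¹' {t | t.2 u ≠ t.1 u} ⊆
      ({t | t.2 u ≠ t.1 u} ×ˢ Set.univ) ∪
        (Set.univ ×ˢ {τ : Fin n → unitInterval | (τ u : ℝ) < r u}) := by
    intro t ht
    simp only [Set.mem_preimage, Set.mem_ofPred_eq, flipMap] at ht
    simp only [Set.mem_union, Set.mem_prod, Set.mem_ofPred_eq, Set.mem_univ, and_true, true_and]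
    by_contra hc
    push Not at hc
    rw [if_neg (not_lt.2 hc.2)] at ht
    exact ht hc.1
  rw [obsLaw, map_measureReal_apply (measurable_flipMap r) MeasurableSet.of_discrete]
  refine (measureReal_mono hsub).trans ((measureReal_union_le _ _).trans ?_)
  rw [measureReal_prod_prod, measureReal_prod_prod, probReal_univ, probReal_univ, mul_one, one_mul]
  gcongr
  have h1 : {τ : Fin n → unitInterval | (τ u : ℝ) < r u}
      = Function.eval u ⁻¹' Set.Iio (⟨r u, hr u⟩ : unitInterval) := by
    ext τ
    simp [← Subtype.coe_lt_coe]
  rw [h1, (measurePreserving_eval (fun _ : Fin n => (volume : Measure unitInterval))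
    u).measureReal_preimage measurableSet_Iio.nullMeasurableSet, measureReal_def, unitInterval.volume_Iio,
    ENNReal.toReal_ofReal (hr u).1]

end

/-! ### Bounding mutual information by a chi-square divergence -/

lemma mul_log_le {J c : ℝ} (hJ : 0 ≤ J) (hc : 0 ≤ c) (hJc : c = 0 → J = 0) :
    J * Real.log (J / c) ≤ J * (J / c) - J := by
  rcases hJ.eq_or_lt with h | h
  · simp [← h]
  · have hc' : 0 < c := hc.lt_of_ne fun h0 => h.ne' (hJc h0.symm)
    have := Real.log_le_sub_one_of_pos (div_pos h hc')
    nlinarith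

lemma sub_le_mul_log {J c : ℝ} (hJ : 0 ≤ J) (hc : 0 ≤ c) (hJc : c = 0 → J = 0) :
    J - c ≤ J * Real.log (J / c) := by
  rcases hJ.eq_or_lt with h | h
  · simp [← h, hc]
  · have hc' : 0 < c := hc.lt_of_ne fun h0 => h.ne' (hJc h0.symm)
    have h1 := Real.one_sub_inv_le_log_of_pos (div_pos h hc')
    have h2 := mul_le_mul_of_nonneg_left h1 hJ
    rw [inv_div, mul_sub, mul_one, mul_div_cancel₀ _ h.ne'] at h2
    exact h2

/-- The upper bound is `log x ≤ x - 1` applied to the likelihood ratio. For a binary variable the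
squares of the two states agree up to sign, and 1/p + 1/(1-p) = 1/(p(1-p)) merges them. The lower
bound is `log x ≥ 1 - 1/x`, whose right-hand sides sum to 0. -/
lemma sum_mul_log_bounds {β : Type*} [Fintype β] {J : Bool → β → ℝ} {P : β → ℝ} {p : ℝ}
    (hJ : ∀ a b, 0 ≤ J a b) (hP : ∀ b, J true b + J false b = P b)
    (hp0 : 0 < p) (hp1 : p < 1) {I : ℝ}
    (hI : I = ∑ a, ∑ b, J a b * Real.log (J a b / ((if a then p else 1 - p) * P b))) :
    0 ≤ I ∧ I ≤ (∑ b, (J true b - p * P b) ^ 2 / P b) / (p * (1 - p)) := by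
  have hPn : ∀ b, 0 ≤ P b := fun b => by rw [← hP]; exact add_nonneg (hJ _ _) (hJ _ _)
  have hq : 0 < 1 - p := by linarith
  have hz : ∀ b, P b = 0 → J true b = 0 ∧ J false b = 0 := fun b hb => by
    have h1 := hJ true b
    have h2 := hJ false b
    have h3 := hP b
    constructor <;> linarith
  have hc1 : ∀ b, p * P b = 0 → J true b = 0 := fun b h =>
    (hz b ((mul_eq_zero.1 h).resolve_left hp0.ne')).1
  have hc2 : ∀ b, (1 - p) * P b = 0 → J false b = 0 := fun b h =>
    (hz b ((mul_eq_zero.1 h).resolve_left hq.ne')).2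
  simp only [Fintype.sum_bool, if_true, Bool.false_eq_true, if_false, ← Finset.sum_add_distrib]
    at hI
  constructor
  · have : ∑ b, (P b - P b) ≤ I := by
      rw [hI]
      refine Finset.sum_le_sum fun b _ => ?_
      have h1 := sub_le_mul_log (hJ true b) (mul_nonneg hp0.le (hPn b)) (hc1 b)
      have h2 := sub_le_mul_log (hJ false b) (mul_nonneg hq.le (hPn b)) (hc2 b)
      linarith [hP b]
    simpa using this
  · rw [hI, Finset.sum_div]
    refine Finset.sum_le_sum fun b _ => ?_
    have h1 := mul_log_le (hJ true b) (mul_nonneg hp0.le (hPn b)) (hc1 b)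
    have h2 := mul_log_le (hJ false b) (mul_nonneg hq.le (hPn b)) (hc2 b)
    refine (add_le_add h1 h2).trans (le_of_eq ?_)
    by_cases hb : P b = 0
    · simp [hb, hz b hb]
    · have hf : J false b = P b - J true b := by linarith [hP b]
      rw [hf]
      field_simp
      ring

lemma mutualInfo_bounds {Ω β : Type*} [MeasurableSpace Ω] [Fintype β] {μ : Measure Ω}
    [IsProbabilityMeasure μ] {A : Ω → Bool} {B : Ω → β} (hA : ∀ a, MeasurableSet {ω | A ω = a})
    (hB : ∀ b, MeasurableSet {ω | B ω = b}) {p : ℝ} (hp : μ.real {ω | A ω = true} = p)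
    (hp0 : 0 < p) (hp1 : p < 1) :
    0 ≤ mutualInfo μ A B ∧ mutualInfo μ A B ≤
      (∑ b, (μ.real {ω | A ω = true ∧ B ω = b} - p * μ.real {ω | B ω = b}) ^ 2 /
        μ.real {ω | B ω = b}) / (p * (1 - p)) := by
  have hf : μ.real {ω | A ω = false} = 1 - p := by
    rw [← hp, ← probReal_compl_eq_one_sub (hA true)]
    congr 1
    ext ω
    simp
  refine sum_mul_log_bounds (J := fun a b => μ.real {ω | A ω = a ∧ B ω = b})
    (P := fun b => μ.real {ω | B ω = b}) (fun _ _ => measureReal_nonneg) (fun b => ?_) hp0 hp1 ?_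
  · rw [← measureReal_union]
    · congr 1
      ext ω
      rcases h : A ω <;> simp [h]
    · rw [Set.disjoint_left]
      rintro ω ⟨h1, _⟩ ⟨h2, _⟩
      simp [h1] at h2
    · exact (hA false).inter (hB b)
  · unfold mutualInfo
    refine Finset.sum_congr rfl fun a _ => Finset.sum_congr rfl fun b _ => ?_
    cases a
    · simp [hf]
    · simp [hp]

/-! ### Averages over permutations of the users -/

section

variable {n m : ℕ}

/-- Permuting the users. -/
def permute (π : Equiv.Perm (Fin n)) (y : Fin m → Fin n → Bool) : Fin m → Fin n → Bool :=
  fun k w => y k (π w)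

/-- The bijection `permute π`. -/
def permuteEquiv (π : Equiv.Perm (Fin n)) :
    (Fin m → Fin n → Bool) ≃ (Fin m → Fin n → Bool) where
  toFun := permute π
  invFun := permute π⁻¹
  left_inv y := by ext; simp [permute]
  right_inv y := by ext; simp [permute]

lemma sum_permute (π : Equiv.Perm (Fin n)) (F : (Fin m → Fin n → Bool) → ℝ) :
    ∑ y, F (permute π y) = ∑ y, F y := (permuteEquiv π).sum_comp F

/-- Average over all permutations of the users. -/
def permAvg (F : (Fin m → Fin n → Bool) → ℝ) (y : Fin m → Fin n → Bool) : ℝ :=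
  (Fintype.card (Equiv.Perm (Fin n)) : ℝ)⁻¹ * ∑ π, F (permute π y)

lemma permAvg_permute (F : (Fin m → Fin n → Bool) → ℝ) (τ : Equiv.Perm (Fin n))
    (y : Fin m → Fin n → Bool) : permAvg F (permute τ y) = permAvg F y := by
  unfold permAvg
  congr 1
  exact Equiv.sum_comp (Equiv.mulLeft τ) fun π => F (permute π y)

/-- `permAvg` is the orthogonal projection onto invariant functions, so it disappears when tested
against one. -/
lemma sum_mul_permAvg {g : (Fin m → Fin n → Bool) → ℝ} (hg : ∀ π y, g (permute π y) = g y)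
    (F : (Fin m → Fin n → Bool) → ℝ) : ∑ y, g y * permAvg F y = ∑ y, g y * F y := by
  unfold permAvg
  simp_rw [mul_left_comm (g _)]
  rw [← Finset.mul_sum]
  simp_rw [Finset.mul_sum (Finset.univ : Finset (Equiv.Perm (Fin n)))]
  rw [Finset.sum_comm]
  have : ∀ π : Equiv.Perm (Fin n), ∑ y, g y * F (permute π y) = ∑ y, g y * F y := fun π => by
    rw [← sum_permute π fun y => g y * F y]
    simp_rw [hg]
  simp_rw [this, Finset.sum_const, Finset.card_univ, nsmul_eq_mul]
  rw [inv_mul_cancel_left₀ (by positivity)]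

/-- This is the contraction of conditional expectation in L². With `g` the deviation of the
conditional expectation given the orbit, the divergence `V` equals both `∑ g² W` and `∑ g W (Φ -
p)`, and Cauchy–Schwarz gives `V² ≤ V ∑ W (Φ - p)²`. Since `g` is invariant, `φ` may be replaced by
any `Φ` that invariant functions cannot distinguish from it. -/
lemma chiSquare_permAvg_le {W φ Φ : (Fin m → Fin n → Bool) → ℝ} (hW : ∀ y, 0 ≤ W y) {p : ℝ}
    (hΦ : ∀ g : (Fin m → Fin n → Bool) → ℝ, (∀ π y, g (permute π y) = g y) →
      ∑ y, g y * (φ y * W y) = ∑ y, g y * (Φ y * W y)) :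
    ∑ y, (permAvg (fun z => φ z * W z) y - p * permAvg W y) ^ 2 / permAvg W y
      ≤ ∑ y, W y * (Φ y - p) ^ 2 := by
  set f1 := permAvg (fun z => φ z * W z) with hf1
  set f := permAvg W with hf
  set g : (Fin m → Fin n → Bool) → ℝ := fun y => (f1 y - p * f y) / f y with hg
  have hginv : ∀ π y, g (permute π y) = g y := fun π y => by
    simp only [hg, hf1, hf, permAvg_permute]
  set V := ∑ y, (f1 y - p * f y) ^ 2 / f y with hV
  have h1 : V = ∑ y, g y * W y * (Φ y - p) := by
    have e1 : V = ∑ y, (g y * f1 y - p * (g y * f y)) := by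
      refine Finset.sum_congr rfl fun y _ => ?_
      simp only [hg]
      ring
    rw [e1, Finset.sum_sub_distrib, ← Finset.mul_sum, hf1, hf, sum_mul_permAvg hginv,
      sum_mul_permAvg hginv, hΦ g hginv, Finset.mul_sum, ← Finset.sum_sub_distrib]
    exact Finset.sum_congr rfl fun y _ => by ring
  have h2 : V = ∑ y, g y ^ 2 * W y := by
    have hg2 : ∀ π y, g (permute π y) ^ 2 = g y ^ 2 := fun π y => by rw [hginv]
    rw [← sum_mul_permAvg hg2]
    refine Finset.sum_congr rfl fun y _ => ?_
    change _ = ((f1 y - p * f y) / f y) ^ 2 * f y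
    by_cases hy : f y = 0
    · simp [hy]
    · field_simp
  have hVn : 0 ≤ V := by
    rw [h2]
    exact Finset.sum_nonneg fun y _ => mul_nonneg (sq_nonneg _) (hW y)
  have h3 : V ^ 2 ≤ V * ∑ y, W y * (Φ y - p) ^ 2 := by
    conv_lhs => rw [h1]
    nth_rewrite 1 [h2]
    refine (le_of_eq ?_).trans (Finset.sum_sq_le_sum_mul_sum_of_sq_le_mul Finset.univ
      (r := fun y => g y * W y * (Φ y - p)) (fun y _ => mul_nonneg (sq_nonneg (g y)) (hW y))
      (fun y _ => mul_nonneg (hW y) (sq_nonneg (Φ y - p))) (fun y _ => le_of_eq ?_))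
    · rfl
    · ring
  rcases hVn.eq_or_lt with h | h
  · rw [← h]
    exact Finset.sum_nonneg fun y _ => mul_nonneg (hW y) (sq_nonneg _)
  · rw [sq] at h3
    exact le_of_mul_le_mul_left h3 h

/-! ### Independent Bernoulli samples -/

/-- Mass function of independent Bernoulli samples of all users at one time. -/
def rowMass (q : Fin n → ℝ) (x : Fin n → Bool) : ℝ := ∏ w, bern (q w) (x w)

/-- Mass function of independent Bernoulli samples of all users at all times. -/
def prodMass (q : Fin n → ℝ) (z : Fin m → Fin n → Bool) : ℝ := ∏ k, rowMass q (z k)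

lemma rowMass_nonneg {q : Fin n → ℝ} (hq : ∀ w, q w ∈ Set.Icc (0 : ℝ) 1) (x : Fin n → Bool) :
    0 ≤ rowMass q x := Finset.prod_nonneg fun w _ => bern_nonneg (hq w) _

lemma prodMass_nonneg {q : Fin n → ℝ} (hq : ∀ w, q w ∈ Set.Icc (0 : ℝ) 1)
    (z : Fin m → Fin n → Bool) : 0 ≤ prodMass q z :=
  Finset.prod_nonneg fun _ _ => rowMass_nonneg hq _

lemma sum_rowMass (q : Fin n → ℝ) : ∑ x, rowMass q x = 1 := by
  have := Finset.prod_univ_sum (fun _ : Fin n => (Finset.univ : Finset Bool))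
    fun w b => bern (q w) b
  rw [Fintype.piFinset_univ] at this
  simp only [rowMass, ← this, sum_bern, Finset.prod_const_one]

lemma sum_prodMass_mul (q : Fin n → ℝ) (k : Fin m) (F : (Fin n → Bool) → ℝ) :
    ∑ z, prodMass q z * F (z k) = ∑ x, rowMass q x * F x := by
  have := Finset.prod_univ_sum (fun _ : Fin m => (Finset.univ : Finset (Fin n → Bool)))
    fun l x => rowMass q x * if l = k then F x else 1
  rw [Fintype.piFinset_univ] at this
  have h1 : ∏ l : Fin m, ∑ x, rowMass q x * (if l = k then F x else 1)
      = ∑ x, rowMass q x * F x := by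
    rw [Finset.prod_eq_single k]
    · simp
    · intro l _ hl
      simp [hl, sum_rowMass]
    · simp
  rw [← h1, this]
  refine Finset.sum_congr rfl fun z _ => ?_
  rw [Finset.prod_mul_distrib, prodMass]
  congr 1
  simp

lemma prodMass_permute {q : Fin n → ℝ} {π : Equiv.Perm (Fin n)} (hπ : ∀ w, q (π w) = q w)
    (z : Fin m → Fin n → Bool) : prodMass q (permute π z) = prodMass q z := by
  unfold prodMass rowMass permute
  refine Finset.prod_congr rfl fun k _ => ?_
  rw [← Equiv.prod_comp π fun w => bern (q w) (z k w)]
  simp_rw [hπ]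

lemma exists_perm {q : Fin n → ℝ} {u v c d : Fin n} (huv : u ≠ v) (hcd : c ≠ d) (hud : u ≠ d)
    (hc : q c = q u) (hd : q d = q v) :
    ∃ π : Equiv.Perm (Fin n), (∀ w, q (π w) = q w) ∧ π u = c ∧ π v = d := by
  have hs : ∀ {a b : Fin n}, q b = q a → ∀ w, q (Equiv.swap a b w) = q w := by
    intro a b h w
    rcases eq_or_ne w a with rfl | h1
    · simp [h]
    · rcases eq_or_ne w b with rfl | h2
      · simp [h]
      · rw [Equiv.swap_apply_of_ne_of_ne h1 h2]
  -- The swap of `v` and `d` acts first and fixes `u`; the swap of `u` and `c` then fixes `d`.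
  -- Nothing forbids `c = u`, `c = v` or `d = v`.
  refine ⟨Equiv.swap u c * Equiv.swap v d, fun w => ?_, ?_, ?_⟩
  · rw [Equiv.Perm.mul_apply, hs hc, hs hd]
  · rw [Equiv.Perm.mul_apply, Equiv.swap_apply_of_ne_of_ne huv hud, Equiv.swap_apply_left]
  · rw [Equiv.Perm.mul_apply, Equiv.swap_apply_left,
      Equiv.swap_apply_of_ne_of_ne hud.symm hcd.symm]

lemma isPairing_of_injective {M : ℕ} {c d : Fin M → Fin n}
    (h : Function.Injective (Sum.elim c d)) :
    IsPairing (Finset.univ.filter fun w => ∀ i, c i ≠ w ∧ d i ≠ w)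
      (Finset.univ.image fun i => (c i, d i)) := by
  have hc : ∀ {i j}, c i = c j → i = j := fun {i j} e => Sum.inl_injective (h (a₁ := .inl i)
    (a₂ := .inl j) e)
  have hd : ∀ {i j}, d i = d j → i = j := fun {i j} e => Sum.inr_injective (h (a₁ := .inr i)
    (a₂ := .inr j) e)
  have hcd : ∀ {i j}, c i ≠ d j := fun {i j} e => by
    have := h (a₁ := .inl i) (a₂ := .inr j) e
    simp at this
  constructor
  · rintro (⟨i, hi⟩ | ⟨⟨e, he⟩, s⟩) (⟨j, hj⟩ | ⟨⟨f, hf⟩, t⟩) hh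
    · simp only [pairingMap, Sum.elim_inl] at hh
      simp [hh]
    · simp only [Finset.mem_filter, Finset.mem_univ, true_and] at hi
      obtain ⟨b, _, rfl⟩ := Finset.mem_image.1 hf
      cases t <;> simp only [pairingMap, Sum.elim_inl, Sum.elim_inr] at hh
      · exact absurd hh.symm (hi b).2
      · exact absurd hh.symm (hi b).1
    · simp only [Finset.mem_filter, Finset.mem_univ, true_and] at hj
      obtain ⟨b, _, rfl⟩ := Finset.mem_image.1 he
      cases s <;> simp only [pairingMap, Sum.elim_inl, Sum.elim_inr] at hh
      · exact absurd hh (hj b).2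
      · exact absurd hh (hj b).1
    · obtain ⟨a, _, rfl⟩ := Finset.mem_image.1 he
      obtain ⟨b, _, rfl⟩ := Finset.mem_image.1 hf
      cases s <;> cases t <;> simp [pairingMap] at hh
      · obtain rfl := hd hh; rfl
      · exact absurd hh.symm hcd
      · exact absurd hh hcd
      · obtain rfl := hc hh; rfl
  · intro w
    by_cases hw : ∀ i, c i ≠ w ∧ d i ≠ w
    · exact ⟨Sum.inl ⟨w, by simpa using hw⟩, rfl⟩
    · push Not at hw
      obtain ⟨i, hi⟩ := hw
      have hm : (c i, d i) ∈ Finset.univ.image fun i => (c i, d i) :=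
        Finset.mem_image.2 ⟨i, Finset.mem_univ _, rfl⟩
      by_cases hci : c i = w
      · exact ⟨Sum.inr (⟨_, hm⟩, true), hci⟩
      · exact ⟨Sum.inr (⟨_, hm⟩, false), hi hci⟩

/-- Disjoint pairs of users are independent, so the sum factors and pair `i` contributes its mean,
which is 0. -/
lemma sum_rowMass_mul_mul_eq_zero {M : ℕ} {c d : Fin M → Fin n} {q : Fin n → ℝ}
    (h : Function.Injective (Sum.elim c d)) {ψ : Bool → Bool → ℝ} {i j : Fin M} (hij : i ≠ j)
    (hψ : ∑ b, ∑ b', bern (q (c i)) b * bern (q (d i)) b' * ψ b b' = 0) :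
    ∑ x, rowMass q x * (ψ (x (c i)) (x (d i)) * ψ (x (c j)) (x (d j))) = 0 := by
  classical
  have hpair := isPairing_of_injective h
  have hinj : ∀ a b, (c a, d a) = (c b, d b) → a = b := fun a b e =>
    Sum.inl_injective (h (a₁ := .inl a) (a₂ := .inl b) (congrArg Prod.fst e))
  have key := hpair.sum_prod_eq (fun w b => bern (q w) b) fun e b b' =>
    bern (q e.1) b * bern (q e.2) b' *
      ((if e = (c i, d i) then ψ b b' else 1) * (if e = (c j, d j) then ψ b b' else 1))
  rw [Finset.prod_eq_zero (s := Finset.univ.image fun i => (c i, d i)) (i := (c i, d i))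
    (Finset.mem_image.2 ⟨i, Finset.mem_univ _, rfl⟩), mul_zero] at key
  · rw [← key]
    refine Finset.sum_congr rfl fun x _ => ?_
    rw [rowMass, hpair.prod_eq, mul_assoc]
    congr 1
    simp only [Finset.prod_mul_distrib]
    have : ∀ a, ∏ e ∈ Finset.univ.image (fun i => (c i, d i)),
        (if e = (c a, d a) then ψ (x e.1) (x e.2) else 1) = ψ (x (c a)) (x (d a)) := by
      intro a
      rw [Finset.prod_ite_eq' _ (c a, d a) fun e => ψ (x e.1) (x e.2),
        if_pos (Finset.mem_image.2 ⟨a, Finset.mem_univ _, rfl⟩)]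
    rw [this, this]
  · have hne : (c i, d i) ≠ (c j, d j) := fun e => hij (hinj _ _ e)
    simpa [hne] using hψ

lemma sum_rowMass_mul_pair {q : Fin n → ℝ} {u v : Fin n} (huv : u ≠ v) (ψ : Bool → Bool → ℝ) :
    ∑ x, rowMass q x * ψ (x u) (x v) = ∑ b, ∑ b', bern (q u) b * bern (q v) b' * ψ b b' := by
  classical
  have hinj : Function.Injective (Sum.elim (fun _ : Fin 1 => u) fun _ : Fin 1 => v) := by
    rintro (i | i) (j | j) h
    · rw [Subsingleton.elim i j]
    · exact absurd h huv
    · exact absurd h huv.symm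
    · rw [Subsingleton.elim i j]
  have hpair := isPairing_of_injective hinj
  have key := hpair.sum_prod_eq (fun w b => bern (q w) b) fun e b b' =>
    bern (q e.1) b * bern (q e.2) b' * ψ b b'
  simp only [Finset.univ_unique, Finset.image_singleton, Finset.prod_singleton, sum_bern,
    Finset.prod_const_one, one_mul] at key hpair
  rw [← key]
  refine Finset.sum_congr rfl fun x _ => ?_
  rw [rowMass, hpair.prod_eq, Finset.prod_singleton]
  ring

/-- The variance of an average of `M` uncorrelated terms bounded by 1: only the `M` diagonal terms
of the expanded square remain. -/
lemma sum_rowMass_sq_le {M : ℕ} (hM : 0 < M) {c d : Fin M → Fin n} {q : Fin n → ℝ}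
    (hq : ∀ w, q w ∈ Set.Icc (0 : ℝ) 1) (h : Function.Injective (Sum.elim c d))
    {ψ : Bool → Bool → ℝ} (hψ1 : ∀ b b', |ψ b b'| ≤ 1)
    (hψ : ∀ i, ∑ b, ∑ b', bern (q (c i)) b * bern (q (d i)) b' * ψ b b' = 0) :
    ∑ x, rowMass q x * ((M : ℝ)⁻¹ * ∑ i, ψ (x (c i)) (x (d i))) ^ 2 ≤ (M : ℝ)⁻¹ := by
  have h1 : ∑ x, rowMass q x * ((M : ℝ)⁻¹ * ∑ i, ψ (x (c i)) (x (d i))) ^ 2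
      = (M : ℝ)⁻¹ ^ 2 * ∑ i, ∑ j,
          ∑ x, rowMass q x * (ψ (x (c i)) (x (d i)) * ψ (x (c j)) (x (d j))) := by
    have e : ∀ x, rowMass q x * ((M : ℝ)⁻¹ * ∑ i, ψ (x (c i)) (x (d i))) ^ 2
        = (M : ℝ)⁻¹ ^ 2 * ∑ i, ∑ j,
          rowMass q x * (ψ (x (c i)) (x (d i)) * ψ (x (c j)) (x (d j))) := by
      intro x
      simp_rw [← Finset.mul_sum, ← Finset.sum_mul]
      ring
    simp_rw [e]
    rw [← Finset.mul_sum, Finset.sum_comm]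
    congr 1
    exact Finset.sum_congr rfl fun i _ => Finset.sum_comm
  rw [h1]
  have h2 : ∀ i j, ∑ x, rowMass q x * (ψ (x (c i)) (x (d i)) * ψ (x (c j)) (x (d j)))
      ≤ if i = j then 1 else 0 := by
    intro i j
    split_ifs with hij
    · subst hij
      rw [← sum_rowMass q]
      refine Finset.sum_le_sum fun x _ => mul_le_of_le_one_right (rowMass_nonneg hq x) ?_
      rw [← abs_mul_abs_self]
      exact mul_le_one₀ (hψ1 _ _) (abs_nonneg _) (hψ1 _ _)
    · exact (sum_rowMass_mul_mul_eq_zero h hij (hψ i)).le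
  have hM' : (0 : ℝ) < M := by exact_mod_cast hM
  calc _ ≤ (M : ℝ)⁻¹ ^ 2 * ∑ i : Fin M, ∑ j : Fin M, (if i = j then (1 : ℝ) else 0) := by
        gcongr with i _ j _
        exact h2 i j
    _ = (M : ℝ)⁻¹ := by
        simp
        field_simp

/-- If the users `u` and `v` are hidden among `M` disjoint pairs of users with the same
parameters, then anonymization makes a function of a sample of `u` and `v` almost independent of
the observations. -/
theorem chiSquare_le {M : ℕ} (hM : 0 < M) {c d : Fin M → Fin n} {q : Fin n → ℝ} {u v : Fin n}
    (hq : ∀ w, q w ∈ Set.Icc (0 : ℝ) 1) (h : Function.Injective (Sum.elim c d)) (huv : u ≠ v)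
    (hud : ∀ i, u ≠ d i) (hc : ∀ i, q (c i) = q u) (hd : ∀ i, q (d i) = q v)
    (k : Fin m) {φ : Bool → Bool → ℝ} (hφ : ∀ b b', φ b b' ∈ Set.Icc (0 : ℝ) 1) {p : ℝ}
    (hp : ∑ z : Fin m → Fin n → Bool, φ (z k u) (z k v) * prodMass q z = p) :
    ∑ y : Fin m → Fin n → Bool,
      (permAvg (fun z => φ (z k u) (z k v) * prodMass q z) y - p * permAvg (prodMass q) y) ^ 2 /
        permAvg (prodMass q) y ≤ (M : ℝ)⁻¹ := by
  have hM' : (M : ℝ) ≠ 0 := by exact_mod_cast hM.ne'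
  -- A permutation that preserves the parameters and carries `(u, v)` to `(c i, d i)` leaves both
  -- `g` and `prodMass q` invariant.
  have hswap : ∀ i, ∀ g : (Fin m → Fin n → Bool) → ℝ, (∀ π y, g (permute π y) = g y) →
      ∑ y, g y * (φ (y k u) (y k v) * prodMass q y)
        = ∑ y, g y * (φ (y k (c i)) (y k (d i)) * prodMass q y) := by
    intro i g hg
    have hcd : c i ≠ d i := fun e => by
      have := h (a₁ := .inl i) (a₂ := .inr i) e
      simp at this
    obtain ⟨π, hπ, hu, hv⟩ := exists_perm huv hcd (hud i) (hc i) (hd i)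
    rw [← sum_permute π]
    simp_rw [hg, prodMass_permute hπ]
    simp only [permute, hu, hv]
  -- Averaging over the indistinguishable pairs is what brings the variance down to `1 / M`.
  set Φ : (Fin m → Fin n → Bool) → ℝ :=
    fun y => (M : ℝ)⁻¹ * ∑ i, φ (y k (c i)) (y k (d i)) with hΦdef
  have hΦ : ∀ g : (Fin m → Fin n → Bool) → ℝ, (∀ π y, g (permute π y) = g y) →
      ∑ y, g y * (φ (y k u) (y k v) * prodMass q y) = ∑ y, g y * (Φ y * prodMass q y) := by
    intro g hg
    have e : ∀ y, g y * (Φ y * prodMass q y)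
        = (M : ℝ)⁻¹ * ∑ i, g y * (φ (y k (c i)) (y k (d i)) * prodMass q y) := by
      intro y
      simp only [hΦdef]
      rw [← Finset.mul_sum, ← Finset.sum_mul]
      ring
    simp_rw [e]
    rw [← Finset.mul_sum, Finset.sum_comm]
    simp_rw [← hswap _ g hg]
    rw [Finset.sum_const, Finset.card_univ, Fintype.card_fin, nsmul_eq_mul,
      inv_mul_cancel_left₀ hM']
  refine (chiSquare_permAvg_le (φ := fun z => φ (z k u) (z k v)) (prodMass_nonneg hq) hΦ).trans ?_
  have hpe : p = ∑ b, ∑ b', bern (q u) b * bern (q v) b' * φ b b' := by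
    rw [← sum_rowMass_mul_pair huv, ← hp, ← sum_prodMass_mul q k fun x => φ (x u) (x v)]
    exact Finset.sum_congr rfl fun z _ => mul_comm _ _
  have hp01 : 0 ≤ p ∧ p ≤ 1 := by
    rw [hpe, ← sum_rowMass_mul_pair huv]
    refine ⟨Finset.sum_nonneg fun x _ => mul_nonneg (rowMass_nonneg hq x) (hφ _ _).1, ?_⟩
    rw [← sum_rowMass q]
    exact Finset.sum_le_sum fun x _ => mul_le_of_le_one_right (rowMass_nonneg hq x) (hφ _ _).2
  have hmain := sum_rowMass_sq_le hM hq h (ψ := fun b b' => φ b b' - p)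
    (fun b b' => abs_le.2 ⟨by linarith [(hφ b b').1], by linarith [(hφ b b').2]⟩)
    (fun i => by
      rw [hc, hd]
      have h1 := sum_bern (q u)
      have h2 := sum_bern (q v)
      simp only [Fintype.sum_bool] at h1 h2 hpe ⊢
      linear_combination -hpe - p * (bern (q v) true + bern (q v) false) * h1 - p * h2)
  refine (le_of_eq ?_).trans hmain
  rw [← sum_prodMass_mul q k]
  refine Finset.sum_congr rfl fun z _ => ?_
  simp only [hΦdef]
  rw [Finset.sum_sub_distrib, Finset.sum_const, Finset.card_univ, Fintype.card_fin, nsmul_eq_mul,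
    mul_sub, inv_mul_cancel_left₀ hM']

end

/-! ### Expectations at one time -/

section

variable {S : Scheme} {G : SimpleGraph ℕ} {p : ℕ → ℝ} {ρ : ℕ × ℕ → ℝ} {n m : ℕ}

/-- The numbers `q u` are the parameters of the users of the system of size `n` after stage 1. -/
structure IsStageParam (S : Scheme) (G : SimpleGraph ℕ) (p : ℕ → ℝ) (ρ : ℕ × ℕ → ℝ) (n : ℕ)
    (q : Fin n → ℝ) : Prop where
  mem : ∀ u, q u ∈ Set.Icc (0 : ℝ) 1
  iso : ∀ u ∈ isolated G n, q u = p u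
  edge : ∀ e ∈ edges G n, ∀ z z' : Bool,
    pairExp (p e.1) (p e.2) (ρ (e.1, e.2))
      (fun x y => (S.decor (p e.1) (p e.2) (ρ (e.1, e.2)) (x, y) (z, z')).toReal)
        = bern (q e.1) z * bern (q e.2) z'

lemma IsStageParam.stepExp_stage {q : Fin n → ℝ} (hq : IsStageParam S G p ρ n q)
    (hG : ∀ c : G.ConnectedComponent, c.supp.encard ≤ 2) (g : Fin n → Bool → ℝ) :
    stepExp S G p ρ n (fun _ s => ∏ w, g w (s w)) = ∏ w, ∑ b, bern (q w) b * g w b := by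
  refine stepExp_prod S hG p ρ n (fun w _ s => g w s) _ (fun u hu => ?_) fun e he => ?_
  · rw [isoExp_stage, hq.iso u hu]
  · exact stageExp_stage S (hq.edge e he) _ _

lemma stepExp_single (hG : ∀ c : G.ConnectedComponent, c.supp.encard ≤ 2) (u : Fin n)
    (g : Bool → Bool → ℝ) {c : ℝ} (hI : u ∈ isolated G n → isoExp (p u) g = c)
    (h1 : ∀ v, (u, v) ∈ edges G n →
      stageExp S (p u) (p v) (ρ (u, v)) g (fun _ _ => 1) = c)
    (h2 : ∀ v, (v, u) ∈ edges G n →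
      stageExp S (p v) (p u) (ρ (v, u)) (fun _ _ => 1) g = c) :
    stepExp S G p ρ n (fun x s => g (x u) (s u)) = c := by
  have key := stepExp_prod S hG p ρ n (fun w x s => if w = u then g x s else 1)
    (fun w => if w = u then c else 1) (fun w hw => ?_) fun e he => ?_
  · simp only [Finset.prod_ite_eq', Finset.mem_univ, if_true] at key
    simpa only [Finset.prod_ite_eq', Finset.mem_univ, if_true] using key
  · by_cases h : w = u
    · subst h; simpa using hI hw
    · simp only [h, if_false]; exact isoExp_const_one _
  · obtain ⟨a, b⟩ := e
    have hab : a ≠ b := (mem_edges.1 he).1.ne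
    by_cases ha : a = u
    · subst ha
      simpa [hab.symm] using h1 b he
    · by_cases hb : b = u
      · subst hb
        simpa [ha] using h2 a he
      · simp only [ha, hb, if_false, mul_one]
        rw [stageExp_data_fst S fun _ => 1]
        simp [bern]

lemma stepExp_val (S : Scheme) (hG : ∀ c : G.ConnectedComponent, c.supp.encard ≤ 2) (u : Fin n) :
    stepExp S G p ρ n (fun x _ => val (x u)) = p u := by
  refine stepExp_single hG u (fun x _ => val x) (fun _ => ?_) (fun v _ => ?_) fun v _ => ?_
  · simp [isoExp, bern, val]
  · rw [stageExp_data_fst]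
    simp [bern, val]
  · rw [stageExp_data_snd]
    simp [bern, val]

lemma stepLaw_real (h : Admissible G p ρ) (A : Set ((Fin n → Bool) × (Fin n → Bool)))
    {F : (Fin n → Bool) → (Fin n → Bool) → ℝ} (h1 : ∀ x s, (x, s) ∈ A → F x s = 1)
    (h0 : ∀ x s, (x, s) ∉ A → F x s = 0) :
    (S.stepLaw G p ρ n).real A = stepExp S G p ρ n F := by
  classical
  have hF : (fun x s => if (x, s) ∈ A then 1 else 0) = F := by
    ext x s
    split_ifs with hA
    · rw [h1 x s hA]
    · rw [h0 x s hA]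
  rw [measureReal_def, stepLaw_apply h, hF, ENNReal.toReal_ofReal]
  rw [← hF]
  exact stepExp_nonneg h fun x s => by split_ifs <;> simp

lemma IsStageParam.outParam_eq {q : Fin n → ℝ} (hq : IsStageParam S G p ρ n q)
    (hG : ∀ c : G.ConnectedComponent, c.supp.encard ≤ 2) (h : Admissible G p ρ) (u : Fin n) :
    S.outParam G p ρ n u = q u := by
  rw [Scheme.outParam, stepLaw_real h _ (F := fun _ s => ∏ w, if w = u then val (s w) else 1)]
  · rw [hq.stepExp_stage hG fun w b => if w = u then val b else 1, Finset.prod_eq_single u]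
    · simp [bern, val]
    · intro w _ hw
      simp [hw, bern]
    · simp
  · intro x s hs
    have hs' : s u = true := hs
    simp [hs', val]
  · intro x s hs
    have hs' : ¬ s u = true := hs
    simp [hs', val]

lemma IsStageParam.obsLaw_real {q : Fin n → ℝ} (hq : IsStageParam S G p ρ n q)
    (hG : ∀ c : G.ConnectedComponent, c.supp.encard ≤ 2) (h : Admissible G p ρ) {r : Fin n → ℝ}
    (hr : ∀ u, r u ∈ Set.Icc (0 : ℝ) 1) (z : Fin n → Bool) :
    (obsLaw S G p ρ n r).real {t | t.2 = z} = rowMass (fun w => flipped (q w) (r w)) z := by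
  have := obsLaw_apply (S := S) h hr (fun _ => True) z
  simp only [true_and, if_true, one_mul] at this
  rw [measureReal_def, this,
    hq.stepExp_stage hG fun w s => flipMass (r w) (z w) s, ENNReal.toReal_ofReal]
  · exact Finset.prod_congr rfl fun w _ => sum_bern_mul_flipMass _ _ _
  · refine Finset.prod_nonneg fun w _ => ?_
    rw [sum_bern_mul_flipMass]
    exact bern_nonneg (flipped_mem (hq.mem w) (hr w)) _

lemma IsStageParam.stepExp_val_mul {q : Fin n → ℝ} (hq : IsStageParam S G p ρ n q)
    (hG : ∀ c : G.ConnectedComponent, c.supp.encard ≤ 2) (r : Fin n → ℝ) (u : Fin n)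
    (z : Fin n → Bool) {c : ℝ}
    (hI : u ∈ isolated G n → isoExp (p u) (fun x s => val x * flipMass (r u) (z u) s)
      = c * bern (flipped (q u) (r u)) (z u))
    (h1 : ∀ v, (u, v) ∈ edges G n →
      stageExp S (p u) (p v) (ρ (u, v)) (fun x s => val x * flipMass (r u) (z u) s)
        (fun _ s => flipMass (r v) (z v) s)
        = c * (bern (flipped (q u) (r u)) (z u) * bern (flipped (q v) (r v)) (z v)))
    (h2 : ∀ v, (v, u) ∈ edges G n →
      stageExp S (p v) (p u) (ρ (v, u)) (fun _ s => flipMass (r v) (z v) s)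
        (fun x s => val x * flipMass (r u) (z u) s)
        = c * (bern (flipped (q u) (r u)) (z u) * bern (flipped (q v) (r v)) (z v))) :
    stepExp S G p ρ n (fun x s => val (x u) * ∏ w, flipMass (r w) (z w) (s w))
      = c * rowMass (fun w => flipped (q w) (r w)) z := by
  have key := stepExp_prod S hG p ρ n
    (fun w x s => (if w = u then val x else 1) * flipMass (r w) (z w) s)
    (fun w => (if w = u then c else 1) * bern (flipped (q w) (r w)) (z w))
    (fun w hw => ?_) fun e he => ?_
  · simp only [Finset.prod_mul_distrib, Finset.prod_ite_eq', Finset.mem_univ, if_true] at key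
    exact key
  · by_cases h : w = u
    · subst h; simpa using hI hw
    · simp only [h, if_false, one_mul]
      rw [isoExp_stage, ← hq.iso w hw, sum_bern_mul_flipMass]
  · obtain ⟨a, b⟩ := e
    have hab : a ≠ b := (mem_edges.1 he).1.ne
    by_cases ha : a = u
    · subst ha
      simp only [if_true, hab.symm, if_false, one_mul]
      rw [h1 b he]
      ring
    · by_cases hb : b = u
      · subst hb
        simp only [if_true, ha, if_false, one_mul]
        rw [h2 a he]
        ring
      · simp only [ha, hb, if_false, one_mul]
        rw [stageExp_stage S (hq.edge _ he), sum_bern_mul_flipMass, sum_bern_mul_flipMass]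

lemma div_mem_of_le {a b : ℝ} (h0 : 0 ≤ a) (h : a ≤ b) :
    a / b ∈ Set.Icc (0 : ℝ) 1 ∧ a / b * b = a := by
  refine ⟨⟨div_nonneg h0 (h0.trans h), div_le_one_of_le₀ h (h0.trans h)⟩, ?_⟩
  by_cases hb : b = 0
  · subst hb
    simp [le_antisymm h h0]
  · rw [div_mul_cancel₀ _ hb]

/-- The other groups are independent of `X_u`, so conditioning on all obfuscated samples at one time
is conditioning on those of `u` and `v`. Here `φ` is the quotient of joint and marginal mass; where
the marginal vanishes the joint mass does too (`div_mem_of_le`). For an isolated `u` the function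
ignores its second argument and `v` is arbitrary. -/
lemma IsStageParam.exists_condProb {q : Fin n → ℝ} (hq : IsStageParam S G p ρ n q)
    (hG : ∀ c : G.ConnectedComponent, c.supp.encard ≤ 2) (h : Admissible G p ρ) {r : Fin n → ℝ}
    (hr : ∀ u, r u ∈ Set.Icc (0 : ℝ) 1) {u v : Fin n} (huv : ∀ w : Fin n, G.Adj u w → w = v) :
    ∃ φ : Bool → Bool → ℝ, (∀ b b', φ b b' ∈ Set.Icc (0 : ℝ) 1) ∧ ∀ z,
      (obsLaw S G p ρ n r).real {t | t.1 u = true ∧ t.2 = z}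
        = φ (z u) (z v) * rowMass (fun w => flipped (q w) (r w)) z := by
  have hval : ∀ x, 0 ≤ val x ∧ val x ≤ 1 := fun x => by cases x <;> simp [val]
  have hl : ∀ (w b x s), 0 ≤ val x * flipMass (r w) b s ∧
      val x * flipMass (r w) b s ≤ flipMass (r w) b s := fun w b x s =>
    ⟨mul_nonneg (hval x).1 (flipMass_nonneg (hr w) _ _),
      mul_le_of_le_one_left (flipMass_nonneg (hr w) _ _) (hval x).2⟩
  suffices ∃ φ : Bool → Bool → ℝ, (∀ b b', φ b b' ∈ Set.Icc (0 : ℝ) 1) ∧ ∀ z,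
      stepExp S G p ρ n (fun x s => val (x u) * ∏ w, flipMass (r w) (z w) (s w))
        = φ (z u) (z v) * rowMass (fun w => flipped (q w) (r w)) z by
    obtain ⟨φ, h1, h2⟩ := this
    refine ⟨φ, h1, fun z => ?_⟩
    rw [measureReal_def, obsLaw_apply h hr (fun x => x u = true), ENNReal.toReal_ofReal, ← h2]
    · congr! 3 with x s
      by_cases hx : x u = true <;> simp [val, hx]
    · exact stepExp_nonneg h fun x s => mul_nonneg (by split_ifs <;> simp)
        (Finset.prod_nonneg fun w _ => flipMass_nonneg (hr w) _ _)
  by_cases hu : u ∈ isolated G n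
  · have hne : ∀ v, (u, v) ∉ edges G n ∧ (v, u) ∉ edges G n := fun v =>
      ⟨fun he => mem_isolated.1 hu v (mem_edges.1 he).2,
        fun he => mem_isolated.1 hu v (mem_edges.1 he).2.symm⟩
    have hb : ∀ b, _ := fun b => div_mem_of_le
      (a := isoExp (p u) (fun x s => val x * flipMass (r u) b s))
      (b := bern (flipped (q u) (r u)) b)
      (Finset.sum_nonneg fun x _ => mul_nonneg (bern_pos (h.mem u) x).le (hl u b x x).1) (by
        rw [← sum_bern_mul_flipMass, hq.iso u hu]
        exact Finset.sum_le_sum fun x _ =>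
          mul_le_mul_of_nonneg_left (hl u b x x).2 (bern_pos (h.mem u) x).le)
    exact ⟨fun b _ => _, fun b _ => (hb b).1, fun z => hq.stepExp_val_mul hG r u z
      (fun _ => (hb (z u)).2.symm) (fun v he => absurd he (hne v).1)
      (fun v he => absurd he (hne v).2)⟩
  · have hadj : G.Adj u v := by
      rw [mem_isolated] at hu
      push Not at hu
      obtain ⟨w, hw⟩ := hu
      rwa [← huv w hw]
    rcases lt_trichotomy u v with hlt | heq | hlt
    · have he : (u, v) ∈ edges G n := mem_edges.2 ⟨hlt, hadj⟩
      have hf := h.feasible u v hlt hadj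
      have hb : ∀ b b', _ := fun b b' => div_mem_of_le
        (a := stageExp S (p u) (p v) (ρ (u, v)) (fun x s => val x * flipMass (r u) b s)
          (fun _ s => flipMass (r v) b' s))
        (b := bern (flipped (q u) (r u)) b * bern (flipped (q v) (r v)) b')
        (stageExp_nonneg S hf (fun x s => (hl u b x s).1) fun _ s => flipMass_nonneg (hr v) _ _)
        (by
          rw [← sum_bern_mul_flipMass, ← sum_bern_mul_flipMass,
            ← stageExp_stage S (hq.edge _ he)]
          exact stageExp_mono S hf (fun x s => (hl u b x s).1)
            (fun _ s => flipMass_nonneg (hr v) _ _) (fun x s => (hl u b x s).2)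
            fun _ _ => le_rfl)
      refine ⟨fun b b' => _, fun b b' => (hb b b').1, fun z => hq.stepExp_val_mul hG r u z
        (fun hu' => absurd hu' hu) (fun w hw => ?_) fun w hw => ?_⟩
      · obtain rfl := huv w (mem_edges.1 hw).2
        exact (hb (z u) (z w)).2.symm
      · obtain rfl := huv w (mem_edges.1 hw).2.symm
        exact absurd (mem_edges.1 hw).1 hlt.asymm
    · subst heq
      exact absurd hadj (G.loopless.irrefl _)
    · have he : (v, u) ∈ edges G n := mem_edges.2 ⟨hlt, hadj.symm⟩
      have hf := h.feasible v u hlt hadj.symm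
      have hb : ∀ b b', _ := fun b b' => div_mem_of_le
        (a := stageExp S (p v) (p u) (ρ (v, u)) (fun _ s => flipMass (r v) b' s)
          (fun x s => val x * flipMass (r u) b s))
        (b := bern (flipped (q u) (r u)) b * bern (flipped (q v) (r v)) b')
        (stageExp_nonneg S hf (fun _ s => flipMass_nonneg (hr v) _ _) fun x s => (hl u b x s).1)
        (by
          rw [mul_comm, ← sum_bern_mul_flipMass, ← sum_bern_mul_flipMass,
            ← stageExp_stage S (hq.edge _ he)]
          exact stageExp_mono S hf (fun _ s => flipMass_nonneg (hr v) _ _)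
            (fun x s => (hl u b x s).1) (fun _ _ => le_rfl) fun x s => (hl u b x s).2)
      refine ⟨fun b b' => _, fun b b' => (hb b b').1, fun z => hq.stepExp_val_mul hG r u z
        (fun hu' => absurd hu' hu) (fun w hw => ?_) fun w hw => ?_⟩
      · obtain rfl := huv w (mem_edges.1 hw).2
        exact absurd (mem_edges.1 hw).1 hlt.asymm
      · obtain rfl := huv w (mem_edges.1 hw).2.symm
        exact (hb (z u) (z w)).2.symm

/-! ### Privacy in a system of fixed size -/

lemma law_real_preimage [IsProbabilityMeasure (S.stepLaw G p ρ n)] {r : Fin n → ℝ}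
    (hr : ∀ u, S.flipLaw n (S.outParam G p ρ n u) = Measure.dirac (r u))
    (A : Set ((Fin m → (Fin n → Bool) × (Fin n → Bool)) × Equiv.Perm (Fin n))) :
    (S.law G p ρ n m).real (observe ⁻¹' A)
      = (Fintype.card (Equiv.Perm (Fin n)) : ℝ)⁻¹ *
        ∑ π, (Measure.pi fun _ : Fin m => obsLaw S G p ρ n r).real {t | (t, π) ∈ A} := by
  have := isProbabilityMeasure_obsLaw (S := S) (G := G) (p := p) (ρ := ρ) r
  have hA : MeasurableSet A := MeasurableSet.of_discrete
  rw [← map_measureReal_apply measurable_observe hA, map_observe_law hr, measureReal_def,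
    Measure.prod_apply_symm hA, lintegral_fintype, ENNReal.toReal_sum, Finset.mul_sum]
  · refine Finset.sum_congr rfl fun π _ => ?_
    rw [ENNReal.toReal_mul, PMF.toMeasure_apply_singleton _ _ (measurableSet_singleton _),
      PMF.uniformOfFintype_apply, ENNReal.toReal_inv, ENNReal.toReal_natCast, mul_comm]
    rfl
  · intro π _
    exact ENNReal.mul_ne_top (measure_ne_top _ _) (measure_ne_top _ _)

lemma isProbabilityMeasure_law [IsProbabilityMeasure (S.stepLaw G p ρ n)] {r : Fin n → ℝ}
    (hr : ∀ u, S.flipLaw n (S.outParam G p ρ n u) = Measure.dirac (r u)) :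
    IsProbabilityMeasure (S.law G p ρ n m) := by
  have := isProbabilityMeasure_obsLaw (S := S) (G := G) (p := p) (ρ := ρ) r
  constructor
  rw [← Set.preimage_univ (f := observe), ← Measure.map_apply measurable_observe .univ,
    map_observe_law hr, measure_univ]

lemma pi_real_univ_pi {α : Type*} [MeasurableSpace α] (ν : Measure α) [IsProbabilityMeasure ν]
    (s : Fin m → Set α) :
    (Measure.pi fun _ : Fin m => ν).real (Set.univ.pi s) = ∏ k, ν.real (s k) := by
  rw [measureReal_def, Measure.pi_pi, ENNReal.toReal_prod]
  rfl

/-- `Y = y` means that Z is `y` rearranged by the permutation, so a uniform permutation turns the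
law of Z into its average over rearrangements. -/
lemma IsStageParam.law_real_dataY {q : Fin n → ℝ} (hq : IsStageParam S G p ρ n q)
    (hG : ∀ c : G.ConnectedComponent, c.supp.encard ≤ 2) (h : Admissible G p ρ) {r : Fin n → ℝ}
    (hr01 : ∀ u, r u ∈ Set.Icc (0 : ℝ) 1)
    (hr : ∀ u, S.flipLaw n (S.outParam G p ρ n u) = Measure.dirac (r u))
    (y : Fin m → Fin n → Bool) :
    (S.law G p ρ n m).real {ω | dataY ω = y}
      = permAvg (prodMass fun w => flipped (q w) (r w)) y := by
  have := isProbabilityMeasure_stepLaw S n hG h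
  have := isProbabilityMeasure_obsLaw (S := S) (G := G) (p := p) (ρ := ρ) r
  have hset : {ω : Sample n m | dataY ω = y}
      = observe ⁻¹' {t | ∀ k, (t.1 k).2 = permute t.2 y k} := by
    ext ω
    simp only [Set.mem_ofPred_eq, Set.mem_preimage, observe, permute, funext_iff, dataY]
    refine forall_congr' fun k => ⟨fun hh w => ?_, fun hh w => ?_⟩
    · rw [← hh, Equiv.symm_apply_apply]
    · rw [hh, Equiv.apply_symm_apply]
  rw [hset, law_real_preimage hr, permAvg]
  congr 1
  refine Finset.sum_congr rfl fun π _ => ?_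
  have : {t : Fin m → (Fin n → Bool) × (Fin n → Bool) |
      (t, π) ∈ {t : (Fin m → (Fin n → Bool) × (Fin n → Bool)) × Equiv.Perm (Fin n) |
        ∀ k, (t.1 k).2 = permute t.2 y k}}
      = Set.univ.pi fun k => {t | t.2 = permute π y k} := by
    ext t
    simp
  rw [this, pi_real_univ_pi, prodMass]
  exact Finset.prod_congr rfl fun k _ => hq.obsLaw_real hG h hr01 _

lemma IsStageParam.law_real_dataX_dataY {q : Fin n → ℝ} (hq : IsStageParam S G p ρ n q)
    (hG : ∀ c : G.ConnectedComponent, c.supp.encard ≤ 2) (h : Admissible G p ρ) {r : Fin n → ℝ}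
    (hr01 : ∀ u, r u ∈ Set.Icc (0 : ℝ) 1)
    (hr : ∀ u, S.flipLaw n (S.outParam G p ρ n u) = Measure.dirac (r u))
    (y : Fin m → Fin n → Bool) (k : Fin m) {u v : Fin n} {φ : Bool → Bool → ℝ}
    (hφ : ∀ z, (obsLaw S G p ρ n r).real {t | t.1 u = true ∧ t.2 = z}
        = φ (z u) (z v) * rowMass (fun w => flipped (q w) (r w)) z) :
    (S.law G p ρ n m).real {ω | dataX ω k u = true ∧ dataY ω = y}
      = permAvg (fun z => φ (z k u) (z k v) * prodMass (fun w => flipped (q w) (r w)) z) y := by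
  have := isProbabilityMeasure_stepLaw S n hG h
  have := isProbabilityMeasure_obsLaw (S := S) (G := G) (p := p) (ρ := ρ) r
  have hset : {ω : Sample n m | dataX ω k u = true ∧ dataY ω = y}
      = observe ⁻¹' {t | (t.1 k).1 u = true ∧ ∀ l, (t.1 l).2 = permute t.2 y l} := by
    ext ω
    simp only [Set.mem_ofPred_eq, Set.mem_preimage, observe, permute, funext_iff, dataY]
    refine and_congr_right fun _ => forall_congr' fun k => ⟨fun hh w => ?_, fun hh w => ?_⟩
    · rw [← hh, Equiv.symm_apply_apply]
    · rw [hh, Equiv.apply_symm_apply]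
  rw [hset, law_real_preimage hr, permAvg]
  congr 1
  refine Finset.sum_congr rfl fun π _ => ?_
  have : {t : Fin m → (Fin n → Bool) × (Fin n → Bool) |
      (t, π) ∈ {t : (Fin m → (Fin n → Bool) × (Fin n → Bool)) × Equiv.Perm (Fin n) |
        (t.1 k).1 u = true ∧ ∀ l, (t.1 l).2 = permute t.2 y l}}
      = Set.univ.pi fun l => {t | (l = k → t.1 u = true) ∧ t.2 = permute π y l} := by
    ext t
    simp [forall_and]
  rw [this, pi_real_univ_pi, prodMass]
  have hl : ∀ l, (obsLaw S G p ρ n r).real {t | (l = k → t.1 u = true) ∧ t.2 = permute π y l}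
      = (if l = k then φ (permute π y k u) (permute π y k v) else 1) *
        rowMass (fun w => flipped (q w) (r w)) (permute π y l) := by
    intro l
    by_cases hlk : l = k
    · subst hlk
      simpa using hφ (permute π y l)
    · simpa [hlk] using hq.obsLaw_real hG h hr01 (permute π y l)
  simp_rw [hl]
  rw [Finset.prod_mul_distrib]
  simp

lemma obsLaw_real_fst [IsProbabilityMeasure (S.stepLaw G p ρ n)]
    (hG : ∀ c : G.ConnectedComponent, c.supp.encard ≤ 2) (h : Admissible G p ρ) (r : Fin n → ℝ)
    (u : Fin n) : (obsLaw S G p ρ n r).real {t | t.1 u = true} = p u := by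
  rw [obsLaw, map_measureReal_apply (measurable_flipMap r) MeasurableSet.of_discrete]
  have : flipMap r ⁻¹' {t | t.1 u = true} = {t | t.1 u = true} ×ˢ Set.univ := by
    ext t
    simp [flipMap]
  rw [this, measureReal_prod_prod, probReal_univ, mul_one, ← stepExp_val (p := p) (ρ := ρ) S hG u]
  exact stepLaw_real h _ (fun x s hx => by simp [val, show x u = true from hx])
    fun x s hx => by simp [val, show ¬ x u = true from hx]

lemma law_real_dataX [IsProbabilityMeasure (S.stepLaw G p ρ n)]
    (hG : ∀ c : G.ConnectedComponent, c.supp.encard ≤ 2) (h : Admissible G p ρ) {r : Fin n → ℝ}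
    (hr : ∀ u, S.flipLaw n (S.outParam G p ρ n u) = Measure.dirac (r u))
    (k : Fin m) (u : Fin n) : (S.law G p ρ n m).real {ω | dataX ω k u = true} = p u := by
  have := isProbabilityMeasure_obsLaw (S := S) (G := G) (p := p) (ρ := ρ) r
  have hset : {ω : Sample n m | dataX ω k u = true} = observe ⁻¹' {t | (t.1 k).1 u = true} := rfl
  have hev : {t : Fin m → (Fin n → Bool) × (Fin n → Bool) | (t k).1 u = true}
      = Function.eval k ⁻¹' {t | t.1 u = true} := rfl
  rw [hset, law_real_preimage hr]
  simp only [Set.mem_ofPred_eq]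
  rw [hev, (measurePreserving_eval (fun _ : Fin m => obsLaw S G p ρ n r) k).measureReal_preimage
    MeasurableSet.of_discrete.nullMeasurableSet, obsLaw_real_fst hG h, Finset.sum_const,
    Finset.card_univ, nsmul_eq_mul, inv_mul_cancel_left₀ (by positivity)]

/-- Neither `m` nor `k` enters the bound: the competing pairs have exactly the same parameters,
hence longer records do not help the adversary. -/
theorem IsStageParam.mutualInfo_le {q : Fin n → ℝ} (hq : IsStageParam S G p ρ n q)
    (hG : ∀ c : G.ConnectedComponent, c.supp.encard ≤ 2) (h : Admissible G p ρ) {r : Fin n → ℝ}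
    (hr01 : ∀ u, r u ∈ Set.Icc (0 : ℝ) 1)
    (hr : ∀ u, S.flipLaw n (S.outParam G p ρ n u) = Measure.dirac (r u)) {u v : Fin n}
    (huv : u ≠ v) (huv' : ∀ w : Fin n, G.Adj u w → w = v) {M : ℕ} (hM : 0 < M)
    {c d : Fin M → Fin n} (hcd : Function.Injective (Sum.elim c d)) (hud : ∀ i, u ≠ d i)
    (hc : ∀ i, flipped (q (c i)) (r (c i)) = flipped (q u) (r u))
    (hd : ∀ i, flipped (q (d i)) (r (d i)) = flipped (q v) (r v)) (k : Fin m) :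
    0 ≤ mutualInfo (S.law G p ρ n m) (fun ω => dataX ω k u) (fun ω => dataY ω) ∧
      mutualInfo (S.law G p ρ n m) (fun ω => dataX ω k u) (fun ω => dataY ω)
        ≤ (M : ℝ)⁻¹ / (p u * (1 - p u)) := by
  have := isProbabilityMeasure_stepLaw S n hG h
  have := isProbabilityMeasure_obsLaw (S := S) (G := G) (p := p) (ρ := ρ) r
  have := isProbabilityMeasure_law (m := m) hr
  obtain ⟨hp0, hp1⟩ := h.mem u
  obtain ⟨φ, hφ01, hφ⟩ := hq.exists_condProb hG h hr01 huv'
  have hX : ∀ a, MeasurableSet {ω : Sample n m | dataX ω k u = a} := fun a =>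
    measurable_observe (MeasurableSet.of_discrete
      (s := {t : (Fin m → (Fin n → Bool) × (Fin n → Bool)) × Equiv.Perm (Fin n) |
        (t.1 k).1 u = a}))
  have hY : ∀ y, MeasurableSet {ω : Sample n m | dataY ω = y} := fun y =>
    measurable_observe (MeasurableSet.of_discrete
      (s := {t : (Fin m → (Fin n → Bool) × (Fin n → Bool)) × Equiv.Perm (Fin n) |
        (fun k w => (t.1 k).2 (t.2.symm w)) = y}))
  obtain ⟨h0, h1⟩ := mutualInfo_bounds hX hY (law_real_dataX hG h hr k u) hp0 hp1
  refine ⟨h0, h1.trans ?_⟩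
  have : 0 ≤ p u * (1 - p u) := mul_nonneg hp0.le (by linarith)
  gcongr
  simp_rw [hq.law_real_dataY hG h hr01 hr, hq.law_real_dataX_dataY hG h hr01 hr _ k hφ]
  refine chiSquare_le hM (fun w => flipped_mem (hq.mem w) (hr01 w)) hcd huv hud hc hd k hφ01 ?_
  -- Law of total probability: the mean of `φ` over the observed row is the probability that `X_u(k)
  -- = 1`.
  rw [← obsLaw_real_fst (S := S) hG h r u]
  have e1 : ∀ z : Fin m → Fin n → Bool,
      φ (z k u) (z k v) * prodMass (fun w => flipped (q w) (r w)) z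
        = prodMass (fun w => flipped (q w) (r w)) z * φ (z k u) (z k v) := fun z => mul_comm _ _
  simp_rw [e1]
  rw [sum_prodMass_mul _ k fun x => φ (x u) (x v)]
  have e2 : ∀ x : Fin n → Bool, rowMass (fun w => flipped (q w) (r w)) x * φ (x u) (x v)
      = (obsLaw S G p ρ n r).real {t | t.1 u = true ∧ t.2 = x} := fun x => by
    rw [hφ, mul_comm]
  simp_rw [e2]
  rw [← measureReal_biUnion_finset]
  · congr 1
    ext t
    simp
  · intro x _ y _ hxy
    rw [Function.onFun, Set.disjoint_left]
    rintro t ⟨_, h1⟩ ⟨_, h2⟩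
    exact hxy (h1.symm.trans h2)
  · exact fun _ _ => MeasurableSet.of_discrete

end

/-! ### Noise -/

section

variable {S : Scheme} {G : SimpleGraph ℕ} {p : ℕ → ℝ} {ρ : ℕ × ℕ → ℝ} {n m : ℕ}

open scoped Classical in
/-- Chebyshev's inequality for the number of successes in `m` independent trials. -/
lemma pi_real_count_le {α : Type*} [MeasurableSpace α] (ν : Measure α) [IsProbabilityMeasure ν]
    {B : Set α} (hB : MeasurableSet B) {d ε : ℝ} (hd : ν.real B ≤ d) (hε : 0 < ε) (hm : 0 < m) :
    (Measure.pi fun _ : Fin m => ν).real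
        {t | (d + ε) * m < (Finset.univ.filter fun k => t k ∈ B).card}
      ≤ 1 / (4 * ε ^ 2 * m) := by
  set μ := Measure.pi fun _ : Fin m => ν with hμ
  have hm' : (0 : ℝ) < m := by exact_mod_cast hm
  let f : α → ℝ := B.indicator 1
  have hf : Measurable f := measurable_one.indicator hB
  have hf01 : ∀ x, f x ∈ Set.Icc (0 : ℝ) 1 := fun x => by
    by_cases hx : x ∈ B <;> simp [f, hx]
  let X : Fin m → (Fin m → α) → ℝ := fun k t => f (t k)
  have hXm : ∀ k, Measurable (X k) := fun k => hf.comp (measurable_pi_apply k)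
  have hX2 : ∀ k, MemLp (X k) 2 μ := fun k =>
    MemLp.of_bound (hXm k).aestronglyMeasurable 1 (ae_of_all _ fun t => by
      rw [Real.norm_eq_abs, abs_of_nonneg (hf01 _).1]
      exact (hf01 _).2)
  have hind : iIndepFun X μ := iIndepFun_pi fun _ => hf.aemeasurable
  have hvar : Var[∑ k, X k; μ] ≤ m / 4 := by
    rw [IndepFun.variance_sum (fun k _ => hX2 k) fun i _ j _ hij => hind.indepFun hij]
    calc ∑ k, Var[X k; μ] ≤ ∑ _k : Fin m, (1 / 4 : ℝ) := Finset.sum_le_sum fun k _ => by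
          have := variance_le_sq_of_bounded (μ := μ) (X := X k) (a := 0) (b := 1)
            (ae_of_all _ fun t => hf01 _) (hXm k).aemeasurable
          norm_num at this ⊢
          exact this
      _ = m / 4 := by
          rw [Finset.sum_const, Finset.card_univ, Fintype.card_fin, nsmul_eq_mul]; ring
  have hmean : ∫ t, (∑ k, X k) t ∂μ = m * ν.real B := by
    simp only [Finset.sum_apply]
    rw [integral_finsetSum _ fun k _ => (hX2 k).integrable one_le_two]
    have : ∀ k, ∫ t, X k t ∂μ = ν.real B := fun k => by
      have h1 := integral_comp_eval (μ := fun _ : Fin m => ν) (i := k) (f := f)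
        hf.aestronglyMeasurable
      simp only [X]
      rw [hμ, h1]
      exact integral_indicator_one hB
    simp [this]
  have hcount : ∀ t, (∑ k, X k) t = ((Finset.univ.filter fun k => t k ∈ B).card : ℝ) := by
    intro t
    rw [Finset.sum_apply, Finset.card_filter]
    push_cast
    refine Finset.sum_congr rfl fun k _ => ?_
    by_cases hk : t k ∈ B <;> simp [X, f, hk]
  have hsub : {t : Fin m → α | (d + ε) * m < (Finset.univ.filter fun k => t k ∈ B).card}
      ⊆ {t | ε * m ≤ |(∑ k, X k) t - ∫ s, (∑ k, X k) s ∂μ|} := by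
    intro t ht
    have ht' : (d + ε) * m < (Finset.univ.filter fun k => t k ∈ B).card := ht
    change ε * m ≤ |(∑ k, X k) t - ∫ s, (∑ k, X k) s ∂μ|
    rw [hmean, hcount]
    refine le_trans ?_ (le_abs_self _)
    nlinarith
  have hch := meas_ge_le_variance_div_sq (memLp_finsetSum' Finset.univ fun k _ => hX2 k)
    (mul_pos hε hm')
  refine (measureReal_mono hsub).trans ?_
  refine (ENNReal.toReal_mono ENNReal.ofReal_ne_top hch).trans ?_
  rw [ENNReal.toReal_ofReal (div_nonneg (variance_nonneg _ _) (sq_nonneg _)),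
    div_le_div_iff₀ (by positivity) (by positivity)]
  have : 0 < 4 * ε ^ 2 * m := by positivity
  calc _ ≤ (m / 4) * (4 * ε ^ 2 * m) := by gcongr
    _ = _ := by ring

lemma noiseFraction_singleton (u : Fin n) (ω : Sample n m) :
    noiseFraction {(u : ℕ)} ω
      = ((Finset.univ.filter fun k : Fin m => dataZ ω k u ≠ dataX ω k u).card : ℝ) / m := by
  have : (Finset.univ.filter fun w : Fin n => (w : ℕ) ∈ ({(u : ℕ)} : Finset ℕ)) = {u} := by
    ext w
    simp [Fin.ext_iff]
  rw [noiseFraction, this]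
  simp

lemma noiseFraction_pair {u v : Fin n} (huv : u ≠ v) (ω : Sample n m) :
    noiseFraction {(u : ℕ), (v : ℕ)} ω
      = (noiseFraction {(u : ℕ)} ω + noiseFraction {(v : ℕ)} ω) / 2 := by
  have : (Finset.univ.filter fun w : Fin n => (w : ℕ) ∈ ({(u : ℕ), (v : ℕ)} : Finset ℕ))
      = {u, v} := by
    ext w
    simp [Fin.ext_iff]
  have hne : (u : ℕ) ≠ v := fun h => huv (Fin.ext h)
  rw [noiseFraction_singleton, noiseFraction_singleton, noiseFraction, this,
    Finset.sum_pair huv, Finset.card_pair hne]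
  push_cast
  rw [← div_div, add_div]

/-- A sample is corrupted by stage 1 with probability at most `b` and flipped in stage 2 with
probability at most `ε`. The second `ε` is the deviation allowed in Chebyshev's inequality. -/
lemma law_real_noiseFraction_le [IsProbabilityMeasure (S.stepLaw G p ρ n)] {r : Fin n → ℝ}
    (hr01 : ∀ u, r u ∈ Set.Icc (0 : ℝ) 1)
    (hr : ∀ u, S.flipLaw n (S.outParam G p ρ n u) = Measure.dirac (r u)) (u : Fin n) {b ε : ℝ}
    (hb : (S.stepLaw G p ρ n).real {t | t.2 u ≠ t.1 u} ≤ b) (hε : 0 < ε) (hrε : r u ≤ ε)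
    (hm : 0 < m) :
    (S.law G p ρ n m).real {ω | b + 2 * ε < noiseFraction {(u : ℕ)} ω} ≤ 1 / (4 * ε ^ 2 * m) := by
  classical
  have := isProbabilityMeasure_obsLaw (S := S) (G := G) (p := p) (ρ := ρ) r
  have hm' : (0 : ℝ) < m := by exact_mod_cast hm
  have key := pi_real_count_le (m := m) (obsLaw S G p ρ n r) (B := {s | s.2 u ≠ s.1 u})
    MeasurableSet.of_discrete ((obsLaw_ne_le hr01 u).trans (add_le_add hb hrε)) hε hm
  set A : Set (Fin m → (Fin n → Bool) × (Fin n → Bool)) := {t | (b + ε + ε) * m <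
    (Finset.univ.filter fun k => t k ∈ {s : (Fin n → Bool) × (Fin n → Bool) | s.2 u ≠ s.1 u}).card}
    with hA
  have hset : {ω : Sample n m | b + 2 * ε < noiseFraction {(u : ℕ)} ω}
      = observe ⁻¹' {t | t.1 ∈ A} := by
    ext ω
    have e : (Finset.univ.filter fun k : Fin m => (observe ω).1 k ∈
        {s : (Fin n → Bool) × (Fin n → Bool) | s.2 u ≠ s.1 u})
        = Finset.univ.filter fun k : Fin m => dataZ ω k u ≠ dataX ω k u :=
      Finset.filter_congr fun k _ => Iff.rfl
    rw [Set.mem_ofPred_eq, Set.mem_preimage, Set.mem_ofPred_eq, hA, Set.mem_ofPred_eq, e,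
      noiseFraction_singleton, lt_div_iff₀ hm', add_assoc, ← two_mul]
  rw [hset, law_real_preimage hr]
  simp only [Set.mem_ofPred_eq, Set.ofPred_mem_eq]
  rw [Finset.sum_const, Finset.card_univ, nsmul_eq_mul, inv_mul_cancel_left₀ (by positivity)]
  convert key using 3
  congr!

end

/-! ### Quantizing the parameters -/

/-- Index of the cell of `q`, when `|1 - 2 q|` is quantized with step `1 / j ^ 2`. -/
def cellIndex (j : ℕ) (q : ℝ) : ℕ := ⌈|1 - 2 * q| * (j : ℝ) ^ 2⌉₊ - 1

/-- The flip probability that moves `q` to the boundary of its cell. -/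
def flipSize (j : ℕ) (q : ℝ) : ℝ :=
  -- Flipping with probability r multiplies `1 - 2 * q` by 1-2r, and this r brings `|1 - 2 * q|`
  -- down to the lower end of its cell. For an index below `j` the required r need not be small, so
  -- nothing is flipped.
  if j ≤ cellIndex j q then (1 - cellIndex j q / (|1 - 2 * q| * (j : ℝ) ^ 2)) / 2 else 0

lemma cellIndex_bounds {j : ℕ} {q : ℝ} (h : 1 ≤ cellIndex j q) :
    (cellIndex j q : ℝ) < |1 - 2 * q| * (j : ℝ) ^ 2 ∧
      |1 - 2 * q| * (j : ℝ) ^ 2 ≤ cellIndex j q + 1 := by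
  have h1 : cellIndex j q + 1 = ⌈|1 - 2 * q| * (j : ℝ) ^ 2⌉₊ := by
    unfold cellIndex at *
    omega
  refine ⟨Nat.lt_ceil.1 (by omega), ?_⟩
  have := Nat.le_ceil (|1 - 2 * q| * (j : ℝ) ^ 2)
  rw [← h1] at this
  exact_mod_cast this

lemma cellIndex_eq {j i : ℕ} {q : ℝ} (h1 : (i : ℝ) < |1 - 2 * q| * (j : ℝ) ^ 2)
    (h2 : |1 - 2 * q| * (j : ℝ) ^ 2 ≤ i + 1) : cellIndex j q = i := by
  have h3 : ⌈|1 - 2 * q| * (j : ℝ) ^ 2⌉₊ = i + 1 := by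
    refine le_antisymm (Nat.ceil_le.2 (by exact_mod_cast h2)) ?_
    exact Nat.lt_ceil.2 h1
  rw [cellIndex, h3, Nat.add_sub_cancel]

lemma flipSize_mem {j : ℕ} (hj : 1 ≤ j) (q : ℝ) : flipSize j q ∈ Set.Icc (0 : ℝ) (1 / j) := by
  have hj' : (0 : ℝ) < j := by exact_mod_cast hj
  unfold flipSize
  split_ifs with h
  · obtain ⟨h1, h2⟩ := cellIndex_bounds (hj.trans h)
    set i := cellIndex j q
    set w := |1 - 2 * q| * (j : ℝ) ^ 2
    have hi : (j : ℝ) ≤ i := by exact_mod_cast h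
    have hw : 0 < w := by linarith
    have h3 : (i : ℝ) / w ≤ 1 := (div_le_one hw).2 h1.le
    -- In units of the cell width, `w ≤ i + 1` and `i ≥ j`, so moving to the lower end is a relative
    -- change of at most `1 / j`.
    have h4 : 1 - 1 / (j : ℝ) ≤ i / w := by
      rw [le_div_iff₀ hw, sub_mul, one_mul, div_mul_eq_mul_div, one_mul, sub_le_iff_le_add,
        ← sub_le_iff_le_add', le_div_iff₀ hj']
      nlinarith
    have h5 : (0 : ℝ) ≤ 1 / j := by positivity
    constructor <;> linarith
  · exact ⟨le_rfl, by positivity⟩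

/-- After the flip the parameter is an end of the cell, which depends only on the index and on the
side of 1/2. -/
lemma flipped_flipSize_eq {j : ℕ} (hj : 1 ≤ j) {q q' : ℝ} (h : j ≤ cellIndex j q)
    (hi : cellIndex j q' = cellIndex j q) (hs : 0 < 1 - 2 * q' ↔ 0 < 1 - 2 * q) :
    flipped q' (flipSize j q') = flipped q (flipSize j q) := by
  have hj' : (0 : ℝ) < j := by exact_mod_cast hj
  have key : ∀ x : ℝ, j ≤ cellIndex j x →
      flipped x (flipSize j x)
        = (1 - (if 0 < 1 - 2 * x then 1 else -1) * (cellIndex j x / (j : ℝ) ^ 2)) / 2 := by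
    intro x hx
    obtain ⟨h1, -⟩ := cellIndex_bounds (hj.trans hx)
    have hpos : 0 < |1 - 2 * x| := by
      by_contra hc
      have : |1 - 2 * x| = 0 := le_antisymm (not_lt.1 hc) (abs_nonneg _)
      rw [this, zero_mul] at h1
      exact absurd h1 (not_lt.2 (Nat.cast_nonneg _))
    rw [flipSize, if_pos hx, flipped]
    set i := (cellIndex j x : ℝ)
    have e2 : (1 - 2 * x) * (i / ((1 - 2 * x) * (j : ℝ) ^ 2)) = i / (j : ℝ) ^ 2 := by
      rw [mul_div_assoc', mul_div_mul_left _ _ (abs_pos.1 hpos)]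
    split_ifs with hx'
    · rw [abs_of_pos hx']
      linear_combination (-1 / 2) * e2
    · have hneg : 1 - 2 * x < 0 := lt_of_le_of_ne (not_lt.1 hx') (abs_pos.1 hpos)
      rw [abs_of_neg hneg]
      have e : i / (-(1 - 2 * x) * (j : ℝ) ^ 2) = -(i / ((1 - 2 * x) * (j : ℝ) ^ 2)) := by
        rw [neg_mul, div_neg]
      rw [e]
      linear_combination (1 / 2) * e2
  rw [key q h, key q' (hi ▸ h), hi]
  simp only [hs]

/-- A fixed `q ≠ 1/2` satisfies the hypothesis for all large `j`, so it eventually lies in a cell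
that is quantized. -/
lemma le_cellIndex {j : ℕ} {q : ℝ} (h : 2 ≤ |1 - 2 * q| * j) : j ≤ cellIndex j q := by
  have hj : 1 ≤ j := by
    by_contra hc
    have : j = 0 := by omega
    subst this
    norm_num at h
  have hj' : (1 : ℝ) ≤ j := by exact_mod_cast hj
  have : j < ⌈|1 - 2 * q| * (j : ℝ) ^ 2⌉₊ := Nat.lt_ceil.2 (by nlinarith)
  unfold cellIndex
  omega

lemma cellIndex_lt {j : ℕ} (hj : 1 ≤ j) {q : ℝ} (hq : q ∈ Set.Icc (0 : ℝ) 1) :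
    cellIndex j q < j ^ 2 := by
  have h1 : |1 - 2 * q| ≤ 1 := abs_le.2 ⟨by linarith [hq.2], by linarith [hq.1]⟩
  have : ⌈|1 - 2 * q| * (j : ℝ) ^ 2⌉₊ ≤ j ^ 2 := Nat.ceil_le.2 (by
    push_cast
    exact mul_le_of_le_one_left (by positivity) h1)
  have hj2 : 0 < j ^ 2 := by positivity
  unfold cellIndex
  omega

/-- The scheme that decorrelates associated users with `decorPMF` and quantizes their parameters
at level `lev n`. -/
def quantScheme (lev : ℕ → ℕ) (h1 : ∀ n, 1 ≤ lev n) (hlev : Tendsto lev atTop atTop) : Scheme where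
  decor := decorPMF
  decorrelates p hp p' hp' ρ hρ := ⟨outFst p p' ρ, outSnd p p' ρ, fun z z' => by
    simp only [decorPMF_toReal]
    exact sum_pairMass_mul_decorKernel hp hp' hρ z z'⟩
  a n := 1 / lev n
  a_mem n := by
    have : (1 : ℝ) ≤ lev n := by exact_mod_cast h1 n
    exact ⟨by positivity, by rw [div_le_one (by linarith)]; exact this⟩
  a_tendsto := tendsto_one_div_atTop_nhds_zero_nat.comp hlev
  flipLaw n q := Measure.dirac (flipSize (lev n) q)
  flipLaw_prob _ _ := inferInstance
  flipLaw_supp n q := by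
    rw [ae_dirac_eq]
    exact flipSize_mem (h1 n) q

/-! ### Cells fill up -/

/-- `q` lies in the interior of the cell with index `i`, on the side of `1 / 2` given by `s`. -/
def InCell (j i : ℕ) (s : Bool) (q : ℝ) : Prop :=
  (0 < 1 - 2 * q ↔ s = true) ∧ (i : ℝ) < |1 - 2 * q| * (j : ℝ) ^ 2 ∧
    |1 - 2 * q| * (j : ℝ) ^ 2 < i + 1

/-- User `w` is not altered in stage 1. -/
def Kept (G : SimpleGraph ℕ) (p : ℕ → ℝ) (w : ℕ) : Prop :=
  ∀ v, G.Adj w v → |1 - 2 * p v| < |1 - 2 * p w|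

lemma measurableSet_inCell (j i : ℕ) (s : Bool) : MeasurableSet {q | InCell j i s q} := by
  have h : Measurable fun q : ℝ => InCell j i s q := by
    refine Measurable.and ?_ (Measurable.and ?_ ?_)
    · exact Measurable.iff (measurableSet_setOfPred.1 (measurableSet_lt (by fun_prop) (by fun_prop)))
        measurable_const
    · exact measurableSet_setOfPred.1 (measurableSet_lt (by fun_prop) (by fun_prop))
    · exact measurableSet_setOfPred.1 (measurableSet_lt (by fun_prop) (by fun_prop))
  exact measurableSet_setOfPred.2 h

lemma measure_Ioo_pos {f : ℝ → ℝ} {δ₁ δ₂ : ℝ} (hδ₁ : 0 < δ₁)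
    (hf_in : ∀ x ∈ Set.Ioo (0 : ℝ) 1, δ₁ ≤ f x ∧ f x ≤ δ₂) {ν : Measure ℝ}
    (hν : ν = volume.withDensity (fun x => ENNReal.ofReal (f x))) {a b : ℝ} (ha : 0 ≤ a)
    (hab : a < b) (hb : b ≤ 1) : 0 < ν (Set.Ioo a b) := by
  rw [hν, withDensity_apply _ measurableSet_Ioo]
  calc (0 : ENNReal) < ENNReal.ofReal δ₁ * volume (Set.Ioo a b) := by
        rw [Real.volume_Ioo]
        exact ENNReal.mul_pos (ENNReal.ofReal_pos.2 hδ₁).ne'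
          (ENNReal.ofReal_pos.2 (by linarith)).ne'
    _ = ∫⁻ _ in Set.Ioo a b, ENNReal.ofReal δ₁ := by rw [setLIntegral_const]
    _ ≤ _ := setLIntegral_mono' measurableSet_Ioo fun x hx =>
        ENNReal.ofReal_le_ofReal (hf_in x ⟨by linarith [hx.1], by linarith [hx.2]⟩).1

section

variable {G : SimpleGraph ℕ} {f : ℝ → ℝ} {δ₁ δ₂ : ℝ} {ν : Measure ℝ}

lemma measure_inCell_pos (hδ₁ : 0 < δ₁)
    (hf_in : ∀ x ∈ Set.Ioo (0 : ℝ) 1, δ₁ ≤ f x ∧ f x ≤ δ₂)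
    (hν : ν = volume.withDensity (fun x => ENNReal.ofReal (f x))) {j i : ℕ} (s : Bool)
    (hij : i < j ^ 2) : 0 < ν {q | InCell j i s q} := by
  have hij' : (i : ℝ) + 1 ≤ (j : ℝ) ^ 2 := by exact_mod_cast hij
  have hi : (0 : ℝ) ≤ i := Nat.cast_nonneg _
  set N := (j : ℝ) ^ 2
  have hN : 0 < N := by linarith
  have d1 : (i : ℝ) / N < (i + 1) / N := by gcongr; linarith
  have d2 : ((i : ℝ) + 1) / N ≤ 1 := (div_le_one hN).2 hij'
  have d3 : 0 ≤ (i : ℝ) / N := by positivity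
  cases s
  · refine (measure_Ioo_pos hδ₁ hf_in hν (a := (1 + i / N) / 2) (b := (1 + (i + 1) / N) / 2)
      (by linarith) (by linarith) (by linarith)).trans_le (measure_mono fun q hq => ?_)
    have h1 : (i : ℝ) / N < -(1 - 2 * q) := by linarith [hq.1]
    have h2 : -(1 - 2 * q) < (i + 1) / N := by linarith [hq.2]
    have h3 : 1 - 2 * q < 0 := by linarith
    refine ⟨by simp; linarith, ?_, ?_⟩
    · rw [abs_of_neg h3]; exact (div_lt_iff₀ hN).1 h1
    · rw [abs_of_neg h3]; exact (lt_div_iff₀ hN).1 h2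
  · refine (measure_Ioo_pos hδ₁ hf_in hν (a := (1 - (i + 1) / N) / 2) (b := (1 - i / N) / 2)
      (by linarith) (by linarith) (by linarith)).trans_le (measure_mono fun q hq => ?_)
    have h1 : (i : ℝ) / N < 1 - 2 * q := by linarith [hq.2]
    have h2 : 1 - 2 * q < (i + 1) / N := by linarith [hq.1]
    have h3 : 0 < 1 - 2 * q := by linarith
    refine ⟨by simp [h3], ?_, ?_⟩
    · rw [abs_of_pos h3]; exact (div_lt_iff₀ hN).1 h1
    · rw [abs_of_pos h3]; exact (lt_div_iff₀ hN).1 h2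

lemma measure_near_half_pos (hδ₁ : 0 < δ₁)
    (hf_in : ∀ x ∈ Set.Ioo (0 : ℝ) 1, δ₁ ≤ f x ∧ f x ≤ δ₂)
    (hν : ν = volume.withDensity (fun x => ENNReal.ofReal (f x))) {j i : ℕ}
    (hi : 1 ≤ i) (hij : i < j ^ 2) :
    0 < ν {q | |1 - 2 * q| * (j : ℝ) ^ 2 < i} := by
  have hij' : (i : ℝ) + 1 ≤ (j : ℝ) ^ 2 := by exact_mod_cast hij
  have hi' : (1 : ℝ) ≤ i := by exact_mod_cast hi
  set N := (j : ℝ) ^ 2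
  have hN : 0 < N := by linarith
  have d2 : (i : ℝ) / N ≤ 1 := (div_le_one hN).2 (by linarith)
  have d3 : 0 < (i : ℝ) / N := by positivity
  refine (measure_Ioo_pos hδ₁ hf_in hν (a := (1 - i / N) / 2) (b := (1 + i / N) / 2)
      (by linarith) (by linarith) (by linarith)).trans_le (measure_mono fun q hq => ?_)
  change |1 - 2 * q| * N < i
  rw [← lt_div_iff₀ hN, abs_lt]
  constructor <;> linarith [hq.1, hq.2]

open scoped Classical in
/-- The associate of a user, or the user himself if he has none. -/
def partner (G : SimpleGraph ℕ) (u : ℕ) : ℕ := if h : ∃ v, G.Adj u v then h.choose else u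

lemma partner_eq (hG : ∀ c : G.ConnectedComponent, c.supp.encard ≤ 2) {u v : ℕ}
    (h : G.Adj u v) : partner G u = v := by
  have hex : ∃ v, G.Adj u v := ⟨v, h⟩
  rw [partner, dif_pos hex]
  exact adj_unique hG hex.choose_spec h

lemma partner_partner (hG : ∀ c : G.ConnectedComponent, c.supp.encard ≤ 2) (u : ℕ) :
    partner G (partner G u) = u := by
  by_cases h : ∃ v, G.Adj u v
  · obtain ⟨v, hv⟩ := h
    rw [partner_eq hG hv, partner_eq hG hv.symm]
  · have : partner G u = u := by rw [partner, dif_neg h]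
    rw [this, this]

/-- `partner G` is an involution that sends users that are not leaders to leaders, so finitely many
leaders would leave only finitely many users. -/
lemma infinite_leaders (hG : ∀ c : G.ConnectedComponent, c.supp.encard ≤ 2) :
    {u | u ≤ partner G u}.Infinite := by
  intro hfin
  refine Set.infinite_univ (α := ℕ) ((hfin.union (hfin.image (partner G))).subset ?_)
  intro u _
  rcases le_total u (partner G u) with h | h
  · exact Or.inl h
  · refine Or.inr ⟨partner G u, ?_, partner_partner hG u⟩
    change partner G u ≤ partner G (partner G u)
    rwa [partner_partner hG]

-- Second Borel–Cantelli lemma, applied to one event per group: the smaller user falls into the cell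
-- and his associate, if any, falls closer to 1/2 than the whole cell. These events concern disjoint
-- sets of coordinates, and their probabilities are bounded below by a constant `c` independent of
-- the group.
open scoped Classical in
lemma ae_infinite_kept [IsProbabilityMeasure ν]
    (hG : ∀ c : G.ConnectedComponent, c.supp.encard ≤ 2) (hδ₁ : 0 < δ₁)
    (hf_in : ∀ x ∈ Set.Ioo (0 : ℝ) 1, δ₁ ≤ f x ∧ f x ≤ δ₂)
    (hν : ν = volume.withDensity (fun x => ENNReal.ofReal (f x))) {j i : ℕ} (s : Bool)
    (hi : 1 ≤ i) (hij : i < j ^ 2) :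
    ∀ᵐ p ∂Measure.infinitePi (fun _ : ℕ => ν),
      {w | InCell j i s (p w) ∧ Kept G p w}.Infinite := by
  set P := Measure.infinitePi (fun _ : ℕ => ν) with hP
  have := (infinite_leaders hG).to_subtype
  let e : ℕ ↪ {u | u ≤ partner G u} := Infinite.natEmbedding _
  -- The condition on a coordinate depends only on whether the user leads his group, so a single
  -- family `t` describes all the events, and finite intersections of them are again boxes.
  let t : ℕ → Set ℝ := fun w =>
    if w ≤ partner G w then {q | InCell j i s q} else {q | |1 - 2 * q| * (j : ℝ) ^ 2 < i}
  have ht : ∀ w, MeasurableSet (t w) := fun w => by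
    by_cases h : w ≤ partner G w
    · simp only [t, h, if_true]
      exact measurableSet_inCell j i s
    · simp only [t, h, if_false]
      exact measurableSet_lt (by fun_prop) (by fun_prop)
  let D : ℕ → Finset ℕ := fun k => {(e k : ℕ), partner G (e k)}
  let A : ℕ → Set (ℕ → ℝ) := fun k => (D k : Set ℕ).pi t
  have hdisj : ∀ k l, k ≠ l → Disjoint (D k) (D l) := by
    intro k l hkl
    have hne : (e k : ℕ) ≠ e l := fun h => hkl (e.injective (Subtype.ext h))
    have hk : (e k : ℕ) ≤ partner G (e k) := (e k).2
    have hl : (e l : ℕ) ≤ partner G (e l) := (e l).2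
    have hpk := partner_partner hG (e k)
    have hpl := partner_partner hG (e l)
    have h1 : (e k : ℕ) ≠ partner G (e l) := fun h => by
      rw [h, hpl] at hk
      exact hne (h.trans (le_antisymm hk hl))
    have h2 : partner G (e k) ≠ e l := fun h => by
      rw [← h, hpk] at hl
      exact hne ((le_antisymm hk hl).trans h)
    have h3 : partner G (e k) ≠ partner G (e l) := fun h => by
      rw [← hpk, ← hpl, h] at hne
      exact hne rfl
    rw [Finset.disjoint_left]
    intro w hw hw'
    simp only [D, Finset.mem_insert, Finset.mem_singleton] at hw hw'
    rcases hw with rfl | rfl <;> rcases hw' with h | h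
    · exact hne h
    · exact h1 h
    · exact h2 h
    · exact h3 h
  have hAm : ∀ k, MeasurableSet (A k) := fun k =>
    MeasurableSet.pi (Finset.countable_toSet _) fun w _ => ht w
  have hind : iIndepSet A P := by
    rw [iIndepSet_iff_meas_biInter hAm]
    intro F
    have : ⋂ k ∈ F, A k = ((F.biUnion D : Finset ℕ) : Set ℕ).pi t := by
      ext p
      simp only [A, Set.mem_iInter, Set.mem_pi, Finset.mem_coe, Finset.mem_biUnion]
      exact ⟨fun h w ⟨k, hk, hw⟩ => h k hk w hw, fun h k hk w hw => h w ⟨k, hk, hw⟩⟩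
    rw [this, hP, Measure.infinitePi_pi _ fun w _ => ht w,
      Finset.prod_biUnion fun k _ l _ hkl => hdisj k l hkl]
    exact Finset.prod_congr rfl fun k _ => (Measure.infinitePi_pi _ fun w _ => ht w).symm
  set c := ν {q | InCell j i s q} * ν {q | |1 - 2 * q| * (j : ℝ) ^ 2 < i} with hc
  have hc0 : c ≠ 0 := (ENNReal.mul_pos (measure_inCell_pos hδ₁ hf_in hν s hij).ne'
    (measure_near_half_pos hδ₁ hf_in hν hi hij).ne').ne'
  have hAc : ∀ k, c ≤ P (A k) := by
    intro k
    rw [hP, Measure.infinitePi_pi _ fun w _ => ht w]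
    have hk : (e k : ℕ) ≤ partner G (e k) := (e k).2
    have hte : t (e k) = {q | InCell j i s q} := by simp only [t, hk, if_true]
    by_cases hpe : partner G (e k) = e k
    · have : D k = {(e k : ℕ)} := by simp [D, hpe]
      rw [this, Finset.prod_singleton, hte]
      exact mul_le_of_le_one_right' prob_le_one
    · have hnl : ¬ partner G (e k) ≤ partner G (partner G (e k)) := by
        rw [partner_partner hG]
        exact fun h => hpe (le_antisymm h hk)
      have htp : t (partner G (e k)) = {q | |1 - 2 * q| * (j : ℝ) ^ 2 < i} := by
        simp only [t, hnl, if_false]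
      rw [show D k = {(e k : ℕ), partner G (e k)} from rfl, Finset.prod_pair (Ne.symm hpe), hte,
        htp]
  have hsum : ∑' k, P (A k) = ⊤ :=
    top_unique ((ENNReal.tsum_const_eq_top_of_ne_zero hc0).symm.le.trans
      (ENNReal.tsum_le_tsum hAc))
  have hone := measure_limsup_eq_one hAm hind hsum
  have hae : ∀ᵐ p ∂P, p ∈ limsup A atTop :=
    (prob_compl_eq_zero_iff (MeasurableSet.measurableSet_limsup hAm)).2 hone
  filter_upwards [hae] with p hp
  rw [mem_limsup_iff_frequently_mem, Nat.frequently_atTop_iff_infinite] at hp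
  refine (hp.image (f := fun k => (e k : ℕ)) (fun a _ b _ h => e.injective (Subtype.ext h))).mono ?_
  rintro _ ⟨k, hk, rfl⟩
  have hk' : ∀ w ∈ D k, p w ∈ t w := fun w hw => hk w (Finset.mem_coe.2 hw)
  have hle : (e k : ℕ) ≤ partner G (e k) := (e k).2
  have h1 : InCell j i s (p (e k)) := by
    have := hk' (e k) (by simp [D])
    simp only [t, hle, if_true] at this
    exact this
  refine ⟨h1, fun v hv => ?_⟩
  have hpv := partner_eq hG hv
  have hnl : ¬ v ≤ partner G v := by
    rw [partner_eq hG hv.symm]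
    rw [hpv] at hle
    exact fun h => hv.ne (le_antisymm hle h)
  have h2 : |1 - 2 * p v| * (j : ℝ) ^ 2 < i := by
    have := hk' v (by simp [D, hpv])
    simp only [t, hnl, if_false] at this
    exact this
  exact lt_of_mul_lt_mul_right (h2.trans h1.2.1) (by positivity)

end

/-! ### Choice of the quantization levels -/

/-- At level `j`, every cell that is far enough from `1 / 2` holds at least `j` unaltered users
`w < N`. -/
def Filled (G : SimpleGraph ℕ) (j N : ℕ) (p : ℕ → ℝ) : Prop :=
  ∀ i : ℕ, ∀ s : Bool, j ≤ i → i < j ^ 2 → ∃ T : Finset ℕ, j ≤ T.card ∧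
    ∀ w, w ∈ T → w < N ∧ InCell j i s (p w) ∧ Kept G p w

lemma Filled.mono {G : SimpleGraph ℕ} {j N N' : ℕ} {p : ℕ → ℝ} (h : Filled G j N p)
    (hN : N ≤ N') : Filled G j N' p := fun i s h1 h2 => by
  obtain ⟨T, hT, hw⟩ := h i s h1 h2
  exact ⟨T, hT, fun w hwT => ⟨(hw w hwT).1.trans_le hN, (hw w hwT).2⟩⟩

lemma measurable_filled (G : SimpleGraph ℕ) (j N : ℕ) : Measurable (Filled G j N) := by
  refine Measurable.forall fun i => Measurable.forall fun s => Measurable.imp measurable_const <|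
    Measurable.imp measurable_const <| Measurable.exists fun T => Measurable.and measurable_const <|
      Measurable.forall fun w => Measurable.imp measurable_const <|
        Measurable.and measurable_const <| Measurable.and ?_ ?_
  · exact (measurableSet_setOfPred.1 (measurableSet_inCell j i s)).comp (measurable_pi_apply w)
  · refine Measurable.forall fun v => Measurable.imp measurable_const ?_
    exact measurableSet_setOfPred.1 (measurableSet_lt (by fun_prop) (by fun_prop))

/-- The levels belong to the scheme and must not depend on `p`. So sizes `N j` are chosen at which
the cells of level `j` fail to be filled with probability at most `2⁻¹ ^ j`. By the first
Borel–Cantelli lemma almost every `p` fails at finitely many levels only, and level `j` is used only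
once `n ≥ N j`. -/
lemma exists_levels {G : SimpleGraph ℕ} {P : Measure (ℕ → ℝ)} [IsProbabilityMeasure P]
    (h : ∀ j i s, 1 ≤ i → i < j ^ 2 → ∀ᵐ p ∂P, {w | InCell j i s (p w) ∧ Kept G p w}.Infinite) :
    ∃ lev : ℕ → ℕ, (∀ n, 1 ≤ lev n) ∧ Tendsto lev atTop atTop ∧
      ∀ᵐ p ∂P, ∀ᶠ n in atTop, Filled G (lev n) n p := by
  classical
  have hfill : ∀ j, 1 ≤ j → ∀ᵐ p ∂P, ∃ N, Filled G j N p := by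
    intro j hj
    have hall : ∀ᵐ p ∂P, ∀ i s, 1 ≤ i → i < j ^ 2 →
        {w | InCell j i s (p w) ∧ Kept G p w}.Infinite := by
      rw [ae_all_iff]; intro i
      rw [ae_all_iff]; intro s
      rw [ae_all_iff]; intro h1
      rw [ae_all_iff]; intro h2
      exact h j i s h1 h2
    filter_upwards [hall] with p hp
    have hT : ∀ i s, ∃ T : Finset ℕ, j ≤ i → i < j ^ 2 → j ≤ T.card ∧
        ∀ w ∈ T, InCell j i s (p w) ∧ Kept G p w := by
      intro i s
      by_cases hi : j ≤ i ∧ i < j ^ 2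
      · obtain ⟨T, hT, hc⟩ := (hp i s (hj.trans hi.1) hi.2).exists_subset_card_eq j
        exact ⟨T, fun _ _ => ⟨hc.ge, fun w hw => hT hw⟩⟩
      · exact ⟨∅, fun h1 h2 => absurd ⟨h1, h2⟩ hi⟩
    choose T hT using hT
    refine ⟨((Finset.range (j ^ 2)).sup fun i => (T i true ∪ T i false).sup id) + 1,
      fun i s h1 h2 => ⟨T i s, (hT i s h1 h2).1, fun w hw => ⟨?_, (hT i s h1 h2).2 w hw⟩⟩⟩
    have hwu : w ∈ T i true ∪ T i false := by cases s <;> simp [hw]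
    have h3 : w ≤ (T i true ∪ T i false).sup id := Finset.le_sup (f := id) hwu
    have h4 := Finset.le_sup (f := fun i => (T i true ∪ T i false).sup id)
      (Finset.mem_range.2 h2)
    exact Nat.lt_succ_of_le (h3.trans h4)
  have hN : ∀ j, ∃ N, 1 ≤ j → P {p | Filled G j N p}ᶜ ≤ (2 : ENNReal)⁻¹ ^ j := by
    intro j
    by_cases hj : 1 ≤ j
    · have hmono : Antitone fun N => {p | Filled G j N p}ᶜ := fun N N' hNN =>
        Set.compl_subset_compl.2 fun p hp => Filled.mono hp hNN
      have htend := tendsto_measure_iInter_atTop (μ := P)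
        (s := fun N => {p | Filled G j N p}ᶜ)
        (fun N => (measurableSet_setOfPred.2 (measurable_filled G j N)).compl.nullMeasurableSet)
        hmono ⟨0, measure_ne_top _ _⟩
      have hzero : P (⋂ N, {p | Filled G j N p}ᶜ) = 0 := by
        have := hfill j hj
        rw [ae_iff] at this
        convert this using 2
        ext p
        simp
      rw [hzero] at htend
      have hev := htend.eventually_le_const
        (ENNReal.pow_pos (ENNReal.inv_pos.2 ENNReal.ofNat_ne_top) j : (0 : ENNReal) < 2⁻¹ ^ j)
      obtain ⟨N, hN⟩ := hev.exists
      exact ⟨N, fun _ => hN⟩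
    · exact ⟨0, fun h => absurd h hj⟩
  choose N hN using hN
  have hBC : ∀ᵐ p ∂P, ∀ᶠ j in atTop, Filled G (j + 1) (N (j + 1)) p := by
    refine ae_eventually_notMem (s := fun j => {p | Filled G (j + 1) (N (j + 1)) p}ᶜ) ?_ |>.mono
      fun p hp => hp.mono fun j hj => by simpa using hj
    refine ne_top_of_le_ne_top ?_ (ENNReal.tsum_le_tsum fun j => hN (j + 1) (by omega))
    rw [ENNReal.tsum_geometric_add_one]
    norm_num
  -- The greatest admissible level among those up to `n`. It tends to infinity without any
  -- monotonicity of `N`; its default value 0 occurs for small `n` only.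
  let g : ℕ → ℕ := fun n => Nat.findGreatest (fun j => N j ≤ n) n
  have hg : Tendsto g atTop atTop := by
    rw [tendsto_atTop]
    intro b
    filter_upwards [eventually_ge_atTop b, eventually_ge_atTop (N b)] with n h1 h2
    exact Nat.le_findGreatest h1 h2
  have hgN : ∀ᶠ n in atTop, N (g n) ≤ n := by
    filter_upwards [eventually_ge_atTop 1, eventually_ge_atTop (N 1)] with n h1 h2
    exact Nat.findGreatest_spec (P := fun j => N j ≤ n) h1 h2
  refine ⟨fun n => max 1 (g n), fun n => le_max_left _ _,
    tendsto_atTop_mono (fun n => le_max_right 1 (g n)) hg, ?_⟩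
  filter_upwards [hBC] with p hp
  have hp' : ∀ᶠ j in atTop, Filled G j (N j) p := by
    rw [eventually_atTop] at hp ⊢
    obtain ⟨a, ha⟩ := hp
    refine ⟨a + 1, fun j hj => ?_⟩
    have := ha (j - 1) (by omega)
    rwa [Nat.sub_add_cancel (by omega)] at this
  filter_upwards [hg.eventually hp', hgN, hg.eventually_ge_atTop 1] with n h1 h2 h3
  rw [max_eq_right h3]
  exact h1.mono h2

/-! ### Generic parameters -/

/-- Properties of the parameters that hold almost surely. -/
structure Generic (G : SimpleGraph ℕ) (p : ℕ → ℝ) (ρ : ℕ × ℕ → ℝ) : Prop extends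
    Admissible G p ρ where
  ne_half : ∀ u, p u ≠ 1 / 2
  outFst_ne : ∀ u v, u < v → G.Adj u v → outFst (p u) (p v) (ρ (u, v)) ≠ 1 / 2
  outSnd_ne : ∀ u v, u < v → G.Adj u v → outSnd (p u) (p v) (ρ (u, v)) ≠ 1 / 2

lemma subsingleton_condMass_eq {p p' : ℝ} (hp : p ∈ Set.Ioo (0 : ℝ) 1)
    (hp' : p' ∈ Set.Ioo (0 : ℝ) 1) (x : Bool) (c : ℝ) :
    {r | condMass p p' r x true = c}.Subsingleton := by
  intro r hr r' hr'
  have h1 : condMass p p' r x true = condMass p p' r' x true := Eq.trans hr (Eq.symm hr')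
  rw [condMass_true_eq hp, condMass_true_eq hp, add_right_inj] at h1
  refine mul_right_cancel₀ ?_ h1
  have h2 : 0 < p * (1 - p) * (p' * (1 - p')) :=
    mul_pos (mul_pos hp.1 (by linarith [hp.2])) (mul_pos hp'.1 (by linarith [hp'.2]))
  refine div_ne_zero (mul_ne_zero (by cases x <;> simp) (Real.sqrt_pos.2 h2).ne')
    (bern_pos hp x).ne'

/-- The correlation has an absolutely continuous law given `p`, and at most one value of it puts an
altered parameter at 1/2, where quantization would never act. -/
lemma ae_generic {G : SimpleGraph ℕ} {p : ℕ → ℝ} (hp : ∀ u, p u ∈ Set.Ioo (0 : ℝ) 1)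
    (hp2 : ∀ u, p u ≠ 1 / 2) (κ : ℕ × ℕ → Measure ℝ) [∀ e, IsProbabilityMeasure (κ e)]
    (hκ : ∀ u v : ℕ, u < v → G.Adj u v →
      κ (u, v) ≪ volume ∧ ∀ᵐ r ∂κ (u, v), Feasible (p u) (p v) r) :
    ∀ᵐ ρ ∂Measure.infinitePi κ, Generic G p ρ := by
  have key : ∀ᵐ ρ ∂Measure.infinitePi κ, ∀ u v, u < v → G.Adj u v →
      Feasible (p u) (p v) (ρ (u, v)) ∧ outFst (p u) (p v) (ρ (u, v)) ≠ 1 / 2 ∧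
        outSnd (p u) (p v) (ρ (u, v)) ≠ 1 / 2 := by
    rw [ae_all_iff]; intro u
    rw [ae_all_iff]; intro v
    rw [ae_all_iff]; intro huv
    rw [ae_all_iff]; intro hadj
    obtain ⟨hac, hf⟩ := hκ u v huv hadj
    refine (measurePreserving_eval_infinitePi κ (u, v)).quasiMeasurePreserving.ae
      (p := fun r => Feasible (p u) (p v) r ∧ outFst (p u) (p v) r ≠ 1 / 2 ∧
        outSnd (p u) (p v) r ≠ 1 / 2) ?_
    have hnull : ∀ {a b : ℝ}, a ∈ Set.Ioo (0 : ℝ) 1 → b ∈ Set.Ioo (0 : ℝ) 1 → ∀ x : Bool,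
        ∀ᵐ r ∂κ (u, v), condMass a b r x true ≠ 1 / 2 := by
      intro a b ha hb x
      have : volume {r | condMass a b r x true = 1 / 2} = 0 :=
        (subsingleton_condMass_eq ha hb x _).measure_zero _
      rw [ae_iff]
      simpa using hac this
    filter_upwards [hf, hnull (hp u) (hp v) (anchor (p u)), hnull (hp v) (hp u) (anchor (p v))]
      with r h1 h2 h3
    refine ⟨h1, ?_, ?_⟩
    · unfold outFst
      split_ifs
      · exact hp2 u
      · exact h3
    · unfold outSnd
      split_ifs
      · exact h2
      · exact hp2 v
  filter_upwards [key] with ρ hρ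
  exact ⟨⟨hp, fun u v h1 h2 => (hρ u v h1 h2).1⟩, hp2, fun u v h1 h2 => (hρ u v h1 h2).2.1,
    fun u v h1 h2 => (hρ u v h1 h2).2.2⟩

/-! ### Parameters after stage 1 -/

open scoped Classical in
/-- Parameter of user `u` after stage 1, in a system that contains the users with index less
than `n`. -/
def stageParam (G : SimpleGraph ℕ) (p : ℕ → ℝ) (ρ : ℕ × ℕ → ℝ) (n u : ℕ) : ℝ :=
  if G.Adj u (partner G u) ∧ partner G u < n then
    if u < partner G u then outFst (p u) (p (partner G u)) (ρ (u, partner G u))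
    else outSnd (p (partner G u)) (p u) (ρ (partner G u, u))
  else p u

section

variable {G : SimpleGraph ℕ} {p : ℕ → ℝ} {ρ : ℕ × ℕ → ℝ}

lemma stageParam_fst (hG : ∀ c : G.ConnectedComponent, c.supp.encard ≤ 2) {n u v : ℕ}
    (h : G.Adj u v) (huv : u < v) (hv : v < n) :
    stageParam G p ρ n u = outFst (p u) (p v) (ρ (u, v)) := by
  rw [stageParam, partner_eq hG h, if_pos ⟨h, hv⟩, if_pos huv]

lemma stageParam_snd (hG : ∀ c : G.ConnectedComponent, c.supp.encard ≤ 2) {n u v : ℕ}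
    (h : G.Adj u v) (huv : u < v) (hu : u < n) :
    stageParam G p ρ n v = outSnd (p u) (p v) (ρ (u, v)) := by
  rw [stageParam, partner_eq hG h.symm, if_pos ⟨h.symm, hu⟩, if_neg huv.asymm]

lemma Generic.stageParam_mem (h : Generic G p ρ) (n u : ℕ) :
    stageParam G p ρ n u ∈ Set.Icc (0 : ℝ) 1 := by
  unfold stageParam
  split_ifs with h1 h2
  · exact outFst_mem (h.mem _) (h.mem _) (h.feasible _ _ h2 h1.1)
  · have h3 : partner G u < u := lt_of_le_of_ne (not_lt.1 h2) h1.1.ne'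
    exact outSnd_mem (h.mem _) (h.mem _) (h.feasible _ _ h3 h1.1.symm)
  · exact ⟨(h.mem u).1.le, (h.mem u).2.le⟩

lemma Generic.stageParam_ne (h : Generic G p ρ) (n u : ℕ) :
    stageParam G p ρ n u ≠ 1 / 2 := by
  unfold stageParam
  split_ifs with h1 h2
  · exact h.outFst_ne _ _ h2 h1.1
  · have h3 : partner G u < u := lt_of_le_of_ne (not_lt.1 h2) h1.1.ne'
    exact h.outSnd_ne _ _ h3 h1.1.symm
  · exact h.ne_half u

/-- The inequality in `Kept` is strict, so the tie rule of `decorKernel` plays no role and `w` may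
be either end of the edge. -/
lemma stageParam_of_kept {n w : ℕ} (h : Kept G p w) : stageParam G p ρ n w = p w := by
  unfold stageParam
  split_ifs with h1 h2
  · rw [outFst, if_pos (h _ h1.1).le]
  · rw [outSnd, if_neg (not_le.2 (h _ h1.1))]
  · rfl

/-- The parameter can change only when the associate enters the system. -/
lemma stageParam_eventually_const (u : ℕ) :
    ∃ x, ∀ᶠ n in atTop, stageParam G p ρ n u = x := by
  refine ⟨stageParam G p ρ (partner G u + 1) u, ?_⟩
  filter_upwards [eventually_gt_atTop (partner G u)] with n hn
  by_cases ha : G.Adj u (partner G u)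
  · unfold stageParam
    rw [if_pos ⟨ha, hn⟩, if_pos (c := G.Adj u (partner G u) ∧ _) ⟨ha, Nat.lt_succ_self _⟩]
  · unfold stageParam
    rw [if_neg fun hc => ha hc.1, if_neg fun hc => ha hc.1]

variable {lev : ℕ → ℕ} {h1 : ∀ n, 1 ≤ lev n} {hlev : Tendsto lev atTop atTop}

lemma Generic.isStageParam (h : Generic G p ρ)
    (hG : ∀ c : G.ConnectedComponent, c.supp.encard ≤ 2) (n : ℕ) :
    IsStageParam (quantScheme lev h1 hlev) G p ρ n (fun u => stageParam G p ρ n u) where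
  mem u := h.stageParam_mem n u
  iso u hu := by
    rw [mem_isolated] at hu
    exact if_neg fun hc => hu ⟨partner G u, hc.2⟩ hc.1
  edge e he z z' := by
    obtain ⟨hlt, hadj⟩ := mem_edges.1 he
    rw [stageParam_fst hG hadj hlt e.2.2, stageParam_snd hG hadj hlt e.1.2]
    simp only [quantScheme, decorPMF_toReal]
    exact sum_pairMass_mul_decorKernel (h.mem _) (h.mem _) (h.feasible _ _ hlt hadj) z z'

lemma Generic.flipLaw_eq (h : Generic G p ρ)
    (hG : ∀ c : G.ConnectedComponent, c.supp.encard ≤ 2) (n : ℕ) (u : Fin n) :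
    (quantScheme lev h1 hlev).flipLaw n ((quantScheme lev h1 hlev).outParam G p ρ n u)
      = Measure.dirac (flipSize (lev n) (stageParam G p ρ n u)) := by
  rw [(h.isStageParam hG n).outParam_eq hG h.toAdmissible]
  rfl

lemma flipSize_mem_unit {j : ℕ} (hj : 1 ≤ j) (q : ℝ) : flipSize j q ∈ Set.Icc (0 : ℝ) 1 := by
  have := flipSize_mem hj q
  have hj' : (1 : ℝ) ≤ j := by exact_mod_cast hj
  exact ⟨this.1, this.2.trans ((div_le_one (by linarith)).2 hj')⟩

/-! ### Privacy -/

/-- The parameter of user `u` that the adversary sees. -/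
def seenParam (G : SimpleGraph ℕ) (p : ℕ → ℝ) (ρ : ℕ × ℕ → ℝ) (lev : ℕ → ℕ) (n u : ℕ) : ℝ :=
  flipped (stageParam G p ρ n u) (flipSize (lev n) (stageParam G p ρ n u))

/-- The user `u` may be altered in stage 1; only the users he hides among are required to be kept.
His parameter after stage 1 settles at some `x ≠ 1/2`, whose cell is eventually one of those that
`Filled` provides for. -/
lemma Generic.eventually_hidden (h : Generic G p ρ) (h1 : ∀ n, 1 ≤ lev n)
    (hlev : Tendsto lev atTop atTop) (hfill : ∀ᶠ n in atTop, Filled G (lev n) n p) (u : ℕ) :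
    ∀ᶠ n in atTop, ∃ C : Finset (Fin n), lev n ≤ C.card ∧
      ∀ w ∈ C, seenParam G p ρ lev n w = seenParam G p ρ lev n u := by
  obtain ⟨x, hx⟩ := stageParam_eventually_const (G := G) (p := p) (ρ := ρ) u
  obtain ⟨n₀, hn₀⟩ := hx.exists
  have hx01 : x ∈ Set.Icc (0 : ℝ) 1 := hn₀ ▸ h.stageParam_mem n₀ u
  have hx2 : x ≠ 1 / 2 := hn₀ ▸ h.stageParam_ne n₀ u
  have hw : 0 < |1 - 2 * x| := abs_pos.2 fun hc => hx2 (by linarith)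
  have hbig : ∀ᶠ n in atTop, 2 ≤ |1 - 2 * x| * lev n :=
    ((tendsto_natCast_atTop_atTop.comp hlev).const_mul_atTop hw).eventually_ge_atTop 2
  filter_upwards [hx, hfill, hbig] with n hnx hnf hnb
  have hi := le_cellIndex hnb
  obtain ⟨T, hTc, hT⟩ := hnf (cellIndex (lev n) x) (decide (0 < 1 - 2 * x)) hi
    (cellIndex_lt (h1 n) hx01)
  refine ⟨T.attachFin fun w hw => (hT w hw).1, by rwa [Finset.card_attachFin], fun w hw => ?_⟩
  obtain ⟨-, hcell, hkept⟩ := hT w (Finset.mem_attachFin _ |>.1 hw)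
  rw [seenParam, seenParam, hnx, stageParam_of_kept hkept]
  refine flipped_flipSize_eq (h1 n) hi (cellIndex_eq hcell.2.1 hcell.2.2.le) ?_
  rw [hcell.1, decide_eq_true_iff]

/-- The `d i` have to avoid the `M` values of `c` and the user `u`, which leaves `M` choices out of
`2 * M + 1`. The two families may come from the same class. -/
lemma exists_disjoint_families {n M : ℕ} {C C' : Finset (Fin n)} (u : Fin n) (hC : M ≤ C.card)
    (hC' : 2 * M + 1 ≤ C'.card) :
    ∃ c d : Fin M → Fin n, Function.Injective (Sum.elim c d) ∧ (∀ i, c i ∈ C) ∧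
      (∀ i, d i ∈ C') ∧ ∀ i, u ≠ d i := by
  obtain ⟨A, hA, hAc⟩ := Finset.exists_subset_card_eq hC
  have hcard : M ≤ (C' \ insert u A).card := by
    have h1 := Finset.le_card_sdiff (insert u A) C'
    have h2 := Finset.card_insert_le u A
    omega
  obtain ⟨B, hB, hBc⟩ := Finset.exists_subset_card_eq hcard
  have hBm : ∀ i, (B.orderEmbOfFin hBc i : Fin n) ∈ C' \ insert u A := fun i =>
    hB (B.orderEmbOfFin_mem hBc i)
  refine ⟨A.orderEmbOfFin hAc, B.orderEmbOfFin hBc,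
    (A.orderEmbOfFin hAc).injective.sumElim (B.orderEmbOfFin hBc).injective fun i j hij => ?_,
    fun i => hA (A.orderEmbOfFin_mem hAc i), fun i => (Finset.mem_sdiff.1 (hBm i)).1,
    fun i hu => ?_⟩
  · refine (Finset.mem_sdiff.1 (hBm j)).2 (Finset.mem_insert_of_mem ?_)
    rw [← hij]
    exact A.orderEmbOfFin_mem hAc i
  · exact (Finset.mem_sdiff.1 (hBm i)).2 (hu ▸ Finset.mem_insert_self _ _)

theorem Generic.perfectPrivacy (h : Generic G p ρ)
    (hG : ∀ c : G.ConnectedComponent, c.supp.encard ≤ 2)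
    (hfill : ∀ᶠ n in atTop, Filled G (lev n) n p) (m : ℕ → ℕ) (u : ℕ) :
    (quantScheme lev h1 hlev).PerfectPrivacy G p ρ m u := by
  intro k
  obtain ⟨hp0, hp1⟩ := h.mem u
  have hpp : 0 < p u * (1 - p u) := mul_pos hp0 (by linarith)
  have key : ∀ M : ℕ, 0 < M → ∀ᶠ n in atTop, ∀ hn : u < n ∧ k < m n,
      0 ≤ mutualInfo ((quantScheme lev h1 hlev).law G p ρ n (m n))
        (fun ω => dataX ω ⟨k, hn.2⟩ ⟨u, hn.1⟩) (fun ω => dataY ω) ∧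
      mutualInfo ((quantScheme lev h1 hlev).law G p ρ n (m n))
        (fun ω => dataX ω ⟨k, hn.2⟩ ⟨u, hn.1⟩) (fun ω => dataY ω)
          ≤ (M : ℝ)⁻¹ / (p u * (1 - p u)) := by
    intro M hM
    have hidden := h.eventually_hidden (ρ := ρ) h1 hlev hfill
    filter_upwards [hidden u, hidden (partner G u), eventually_gt_atTop (partner G u),
      hlev.eventually_ge_atTop (2 * M + 1)] with n ⟨C, hCc, hC⟩ ⟨C', hCc', hC'⟩ hpn hM' hn
    suffices ∃ v : Fin n, (⟨u, hn.1⟩ : Fin n) ≠ v ∧ (∀ w : Fin n, G.Adj u w → w = v) ∧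
        ∃ C' : Finset (Fin n), lev n ≤ C'.card ∧
          ∀ w ∈ C', seenParam G p ρ lev n w = seenParam G p ρ lev n v by
      obtain ⟨v, huv, huv', C', hCc', hC'⟩ := this
      obtain ⟨c, d, hcd, hc, hd, hud⟩ := exists_disjoint_families (M := M) ⟨u, hn.1⟩
        (C := C) (C' := C') (by omega) (by omega)
      exact (h.isStageParam (h1 := h1) (hlev := hlev) hG n).mutualInfo_le hG h.toAdmissible
        (r := fun w => flipSize (lev n) (stageParam G p ρ n w))
        (fun w => flipSize_mem_unit (h1 n) _) (fun w => h.flipLaw_eq hG n w) huv huv' hM hcd hud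
        (fun i => hC _ (hc i)) (fun i => hC' _ (hd i)) ⟨k, hn.2⟩
    by_cases hadj : ∃ v, G.Adj u v
    · obtain ⟨v, hv⟩ := hadj
      have hpv := partner_eq hG hv
      refine ⟨⟨v, hpv ▸ hpn⟩, fun hc => hv.ne (Fin.ext_iff.1 hc),
        fun w hw => Fin.ext (adj_unique hG hw hv), C', hCc', fun w hw => ?_⟩
      exact (hC' w hw).trans (congrArg _ hpv)
    -- A user without associate is paired with another member of his own class, so that the argument
    -- for pairs covers him as well.
    · obtain ⟨v, hvC, hvu⟩ := Finset.exists_mem_ne (s := C) (by omega) ⟨u, hn.1⟩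
      refine ⟨v, hvu.symm, fun w hw => absurd ⟨_, hw⟩ hadj, C, hCc, fun w hw => ?_⟩
      rw [hC w hw, hC v hvC]
  rw [Metric.tendsto_atTop']
  intro ε hε
  obtain ⟨M, hM⟩ := exists_nat_gt (1 / (ε * (p u * (1 - p u))))
  have hM0 : 0 < M := by
    have : (0 : ℝ) < M := lt_trans (by positivity) hM
    exact_mod_cast this
  obtain ⟨n₀, hn₀⟩ := eventually_atTop.1 (key M hM0)
  refine ⟨n₀, fun n hn => ?_⟩
  rw [Real.dist_eq, sub_zero]
  split_ifs with hcond
  · obtain ⟨k0, k1⟩ := hn₀ n hn.le hcond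
    rw [abs_of_nonneg k0]
    refine k1.trans_lt ?_
    have hM0' : (0 : ℝ) < M := by exact_mod_cast hM0
    rw [div_lt_iff₀ (by positivity)] at hM
    rw [div_lt_iff₀ hpp, inv_lt_iff_one_lt_mul₀ hM0']
    linarith
  · simpa using hε

/-! ### Noise levels -/

lemma asymptoticNoiseLevel_le {S : Scheme} {m : ℕ → ℕ} {U : Finset ℕ} {b : ℝ} (hb : 0 ≤ b)
    (h : ∀ ε > 0, Tendsto (fun n => (S.law G p ρ n (m n)).real {ω | b + ε < noiseFraction U ω})
      atTop (𝓝 0)) :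
    S.asymptoticNoiseLevel G p ρ m U ≤ b := by
  refine le_of_forall_pos_le_add fun ε hε => ?_
  exact csInf_le ⟨0, fun a ha => ha.1⟩ ⟨by linarith, h ε hε⟩

lemma Generic.tendsto_noise (h : Generic G p ρ)
    (hG : ∀ c : G.ConnectedComponent, c.supp.encard ≤ 2) {m : ℕ → ℕ}
    (hm : Tendsto m atTop atTop) (u : ℕ) {b : ℝ}
    (hb : ∀ᶠ n in atTop, ∀ hn : u < n, ((quantScheme lev h1 hlev).stepLaw G p ρ n).real
      {t | t.2 ⟨u, hn⟩ ≠ t.1 ⟨u, hn⟩} ≤ b) {ε : ℝ} (hε : 0 < ε) :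
    Tendsto (fun n => ((quantScheme lev h1 hlev).law G p ρ n (m n)).real
      {ω | b + ε < noiseFraction {u} ω}) atTop (𝓝 0) := by
  have hlim : Tendsto (fun n => 1 / (4 * (ε / 2) ^ 2 * (m n : ℝ))) atTop (𝓝 0) := by
    have : Tendsto (fun n => 4 * (ε / 2) ^ 2 * (m n : ℝ)) atTop atTop :=
      (tendsto_natCast_atTop_atTop.comp hm).const_mul_atTop (by positivity)
    simp only [one_div]
    exact this.inv_tendsto_atTop
  refine squeeze_zero' (Eventually.of_forall fun _ => measureReal_nonneg) ?_ hlim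
  have ha := (quantScheme lev h1 hlev).a_tendsto.eventually_le_const
    (show (0 : ℝ) < ε / 2 by positivity)
  filter_upwards [hb, ha, eventually_gt_atTop u, hm.eventually_ge_atTop 1] with n hbn han hun hmn
  have := isProbabilityMeasure_stepLaw (quantScheme lev h1 hlev) n hG h.toAdmissible
  have key := law_real_noiseFraction_le (m := m n)
    (r := fun w => flipSize (lev n) (stageParam G p ρ n w))
    (fun w => flipSize_mem_unit (h1 n) _) (fun w => h.flipLaw_eq hG n w) ⟨u, hun⟩ (hbn hun)
    (show (0 : ℝ) < ε / 2 by positivity) ((flipSize_mem (h1 n) _).2.trans han) hmn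
  rwa [mul_div_cancel₀ ε two_ne_zero] at key

lemma Generic.stepLaw_noise_fst (h : Generic G p ρ)
    (hG : ∀ c : G.ConnectedComponent, c.supp.encard ≤ 2) {n : ℕ} {u v : Fin n} (huv : u < v)
    (hadj : G.Adj u v) :
    ((quantScheme lev h1 hlev).stepLaw G p ρ n).real {t | t.2 u ≠ t.1 u}
      ≤ pairNoiseBound (p u) (p v) (ρ (u, v)) := by
  rw [stepLaw_real h.toAdmissible _ (F := fun x s => if s u ≠ x u then 1 else 0)
    (fun x s hx => if_pos hx) (fun x s hx => if_neg hx)]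
  refine le_trans (le_of_eq (stepExp_single hG u (fun x s => if s ≠ x then 1 else 0)
    (c := stageExp (quantScheme lev h1 hlev) (p u) (p v) (ρ (u, v))
      (fun x s => if s ≠ x then 1 else 0) fun _ _ => 1) (fun hu => ?_) (fun w hw => ?_)
      fun w hw => ?_)) ?_
  · exact absurd hadj (mem_isolated.1 hu v)
  · obtain rfl := Fin.ext (adj_unique hG hadj (mem_edges.1 hw).2)
    rfl
  · obtain rfl := Fin.ext (adj_unique hG hadj (mem_edges.1 hw).2.symm)
    exact absurd (mem_edges.1 hw).1 huv.asymm
  · have := noise_fst_le (h.mem u) (h.mem v) (h.feasible _ _ huv hadj)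
    simpa only [stageExp, quantScheme, decorPMF_toReal, mul_one] using this

lemma Generic.stepLaw_noise_snd (h : Generic G p ρ)
    (hG : ∀ c : G.ConnectedComponent, c.supp.encard ≤ 2) {n : ℕ} {u v : Fin n} (huv : u < v)
    (hadj : G.Adj u v) :
    ((quantScheme lev h1 hlev).stepLaw G p ρ n).real {t | t.2 v ≠ t.1 v}
      ≤ pairNoiseBound (p u) (p v) (ρ (u, v)) := by
  rw [stepLaw_real h.toAdmissible _ (F := fun x s => if s v ≠ x v then 1 else 0)
    (fun x s hx => if_pos hx) (fun x s hx => if_neg hx)]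
  refine le_trans (le_of_eq (stepExp_single hG v (fun x s => if s ≠ x then 1 else 0)
    (c := stageExp (quantScheme lev h1 hlev) (p u) (p v) (ρ (u, v)) (fun _ _ => 1)
      (fun x s => if s ≠ x then 1 else 0)) (fun hu => ?_) (fun w hw => ?_)
      fun w hw => ?_)) ?_
  · exact absurd hadj.symm (mem_isolated.1 hu u)
  · obtain rfl := Fin.ext (adj_unique hG hadj.symm (mem_edges.1 hw).2)
    exact absurd (mem_edges.1 hw).1 huv.asymm
  · obtain rfl := Fin.ext (adj_unique hG hadj.symm (mem_edges.1 hw).2.symm)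
    rfl
  · have := noise_snd_le (h.mem u) (h.feasible _ _ huv hadj)
    simpa only [stageExp, quantScheme, decorPMF_toReal, one_mul] using this

theorem Generic.noise_levels (h : Generic G p ρ)
    (hG : ∀ c : G.ConnectedComponent, c.supp.encard ≤ 2) {m : ℕ → ℕ}
    (hm : Tendsto m atTop atTop) {u v : ℕ} (huv : u < v) (hadj : G.Adj u v) :
    (quantScheme lev h1 hlev).asymptoticNoiseLevel G p ρ m {u}
        ≤ pairNoiseBound (p u) (p v) (ρ (u, v)) ∧
      (quantScheme lev h1 hlev).asymptoticNoiseLevel G p ρ m {v}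
        ≤ pairNoiseBound (p u) (p v) (ρ (u, v)) ∧
      (quantScheme lev h1 hlev).asymptoticNoiseLevel G p ρ m {u, v}
        ≤ pairNoiseBound (p u) (p v) (ρ (u, v)) := by
  have hb := pairNoiseBound_nonneg (p' := p v) (ρ := ρ (u, v)) (h.mem u)
  have t1 : ∀ ε > 0, Tendsto (fun n => ((quantScheme lev h1 hlev).law G p ρ n (m n)).real
      {ω | pairNoiseBound (p u) (p v) (ρ (u, v)) + ε < noiseFraction {u} ω}) atTop (𝓝 0) :=
    fun ε hε => h.tendsto_noise hG hm u (by
      filter_upwards [eventually_gt_atTop v] with n hvn hn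
      exact h.stepLaw_noise_fst hG (u := ⟨u, hn⟩) (v := ⟨v, hvn⟩) huv hadj) hε
  have t2 : ∀ ε > 0, Tendsto (fun n => ((quantScheme lev h1 hlev).law G p ρ n (m n)).real
      {ω | pairNoiseBound (p u) (p v) (ρ (u, v)) + ε < noiseFraction {v} ω}) atTop (𝓝 0) :=
    fun ε hε => h.tendsto_noise hG hm v (by
      filter_upwards [eventually_gt_atTop u] with n hun hn
      exact h.stepLaw_noise_snd hG (u := ⟨u, hun⟩) (v := ⟨v, hn⟩) huv hadj) hε
  refine ⟨asymptoticNoiseLevel_le hb t1, asymptoticNoiseLevel_le hb t2,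
    asymptoticNoiseLevel_le hb fun ε hε => ?_⟩
  have hsum := (t1 ε hε).add (t2 ε hε)
  rw [add_zero] at hsum
  refine squeeze_zero' (Eventually.of_forall fun _ => measureReal_nonneg) ?_ hsum
  filter_upwards [eventually_gt_atTop v] with n hvn
  have := isProbabilityMeasure_stepLaw (quantScheme lev h1 hlev) n hG h.toAdmissible
  have := isProbabilityMeasure_law (m := m n) (h.flipLaw_eq (h1 := h1) (hlev := hlev) hG n)
  refine (measureReal_mono ?_).trans (measureReal_union_le _ _)
  intro ω hω
  have hω' : pairNoiseBound (p u) (p v) (ρ (u, v)) + ε < noiseFraction {u, v} ω := hω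
  have hpair := noiseFraction_pair (u := ⟨u, huv.trans hvn⟩) (v := ⟨v, hvn⟩)
    (fun hc => huv.ne (Fin.ext_iff.1 hc)) ω
  simp only at hpair
  rw [hpair] at hω'
  -- The fraction of the pair is the average of the two single ones, so it exceeds the bound only if
  -- one of them does.
  by_contra hc
  simp only [Set.mem_union, Set.mem_ofPred_eq, not_or, not_lt] at hc
  linarith [hc.1, hc.2]

end

end CollabPrivacy

end

/-! ### Assembly of the theorem -/

theorem mainTheorem3
    -- the association graph, with groups of size at most `2`
    (G : SimpleGraph ℕ) (hG : ∀ c : G.ConnectedComponent, c.supp.encard ≤ 2)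
    -- the law of the parameters `p_u`, with a density that is bounded and bounded away from zero
    (f : ℝ → ℝ) (hf : Measurable f) (δ₁ δ₂ : ℝ) (hδ₁ : 0 < δ₁)
    (hf_in : ∀ x ∈ Set.Ioo (0 : ℝ) 1, δ₁ ≤ f x ∧ f x ≤ δ₂)
    (hf_out : ∀ x, x ∉ Set.Ioo (0 : ℝ) 1 → f x = 0)
    (ν : MeasureTheory.Measure ℝ) [MeasureTheory.IsProbabilityMeasure ν]
    (hν : ν = MeasureTheory.volume.withDensity (fun x => ENNReal.ofReal (f x)))
    -- the conditional law of the correlation of each associated pair, given its parameters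
    (κ : ℕ × ℕ → ProbabilityTheory.Kernel (ℝ × ℝ) ℝ)
    [∀ e, ProbabilityTheory.IsMarkovKernel (κ e)]
    (hκ : ∀ u v : ℕ, u < v → G.Adj u v →
      ∀ x ∈ Set.Ioo (0 : ℝ) 1, ∀ y ∈ Set.Ioo (0 : ℝ) 1,
        κ (u, v) (x, y) ≪ MeasureTheory.volume ∧
          ∀ᵐ r ∂κ (u, v) (x, y), CollabPrivacy.Feasible x y r) :
    ∃ S : CollabPrivacy.Scheme,
      ∀ᵐ p ∂MeasureTheory.Measure.infinitePi (fun _ : ℕ => ν),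
      ∀ᵐ ρ ∂MeasureTheory.Measure.infinitePi (fun e : ℕ × ℕ => κ e (p e.1, p e.2)),
      ∀ m : ℕ → ℕ, Filter.Tendsto m Filter.atTop Filter.atTop →
        (∀ u : ℕ, S.PerfectPrivacy G p ρ m u) ∧
        ∀ u v : ℕ, u < v → G.Adj u v →
          S.asymptoticNoiseLevel G p ρ m {u}
              ≤ CollabPrivacy.pairNoiseBound (p u) (p v) (ρ (u, v)) ∧
          S.asymptoticNoiseLevel G p ρ m {v}
              ≤ CollabPrivacy.pairNoiseBound (p u) (p v) (ρ (u, v)) ∧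
          S.asymptoticNoiseLevel G p ρ m {u, v}
              ≤ CollabPrivacy.pairNoiseBound (p u) (p v) (ρ (u, v)) := by
  have hIoo : ∀ᵐ x ∂ν, x ∈ Set.Ioo (0 : ℝ) 1 := by
    rw [MeasureTheory.ae_iff, hν, MeasureTheory.withDensity_apply_eq_zero' (by fun_prop)]
    refine MeasureTheory.measure_mono_null ?_ MeasureTheory.measure_empty
    rintro x ⟨h1, h2⟩
    exact h1 (by rw [hf_out x h2, ENNReal.ofReal_zero])
  have hhalf : ∀ᵐ x ∂ν, x ≠ 1 / 2 := by
    have hac : ν ≪ MeasureTheory.volume := hν ▸ MeasureTheory.withDensity_absolutelyContinuous _ _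
    exact hac.ae_le (MeasureTheory.Measure.ae_ne _ _)
  -- The levels use only the law of the parameters, so one scheme serves almost every realization.
  obtain ⟨lev, h1, hlev, hfill⟩ := CollabPrivacy.exists_levels
    (P := MeasureTheory.Measure.infinitePi (fun _ : ℕ => ν)) (G := G)
    fun j i s hi hij => CollabPrivacy.ae_infinite_kept hG hδ₁ hf_in hν s hi hij
  refine ⟨CollabPrivacy.quantScheme lev h1 hlev, ?_⟩
  have hall : ∀ᵐ p ∂MeasureTheory.Measure.infinitePi (fun _ : ℕ => ν),
      ∀ u, p u ∈ Set.Ioo (0 : ℝ) 1 ∧ p u ≠ 1 / 2 :=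
    MeasureTheory.ae_all_iff.2 fun u =>
      (measurePreserving_eval_infinitePi (fun _ : ℕ => ν) u).quasiMeasurePreserving.ae
        (hIoo.and hhalf)
  filter_upwards [hfill, hall] with p hp hp01
  filter_upwards [CollabPrivacy.ae_generic (fun u => (hp01 u).1) (fun u => (hp01 u).2)
    (fun e : ℕ × ℕ => κ e (p e.1, p e.2))
    fun u v huv hadj => hκ u v huv hadj _ (hp01 u).1 _ (hp01 v).1] with ρ hρ m hm
  exact ⟨fun u => hρ.perfectPrivacy hG hp m u, fun u v huv hadj => hρ.noise_levels hG hm huv hadj⟩
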